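/- **Setting.** Consider a finite-horizon MDP with stages $h=1,\dots,H$ ($H\ge 1$), a measurable state space $\mathcal S$, a finite action set $\mathcal A\neq\emptyset$ and an initial distribution $\rho$. Playing $a$ in $s$ at stage $h$ yields a random reward with mean $r_h(s,a)$, bounded by $1$ in absolute value, and a next state $s'\sim\mathbb P_h(\cdot\mid s,a)$. A policy $\pi=(\pi_1,\dots,\pi_H)$ is a family of measurable maps $\pi_h:\mathcal S\to\mathcal A$; $V^\pi_h$ is its value function and $V^*_h=\sup_\pi V^\pi_h$. A controller draws, at the start of each episode, one of finitely many policies from a fixed distribution and plays it for the whole episode (a single policy is a special case). $\mathbb E_\pi$ denotes expectation over the trajectory $(S_1,A_1,\dots,S_H,A_H)$ of $\pi$ with $S_1\sim\rho$. Let $(\mathcal T_hQ)(s,a)=r_h(s,a)+\mathbb E_{s'\sim \mathbb P_h(s,a)}\max_{a'}Q_{h+1}(s',a')$. Let $\phi_h:\mathcal S\times\mathcal A\to\mathbb R^d$ ($d\ge1$) be measurable features with $\|\phi_h(s,a)\|_2\le1$, and let $\mathcal B$ be the Euclidean unit ball of $\mathbb R^d$. For a controller $\pi$ and a function $Q'=(Q'_1,\dots,Q'_{H+1})$,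 a *best on-policy fit* at stage $h$ is any minimizer $\theta^{\star}_h=\theta^{\star}_h(\pi,Q')$ of $\theta\mapsto\mathbb E_\pi\big(\langle\phi_h(S_h,A_h),\theta\rangle-(\mathcal T_hQ')(S_h,A_h)\big)^2$ over $\mathcal B$. **Misspecification.** Let $\mathcal C$ be a class of controllers (for instance all policies). The MDP and $\phi$ are $\varepsilon$-misspecified with respect to the low-rank condition (over $\mathcal C$) if for all $\pi\in\mathcal C$, all policies $\pi'$, and all measurable $Q'$ with $\|Q'_h\|_\infty\le1$ for every $h$ and $Q'_{H+1}=0$, there are best on-policy fits $\theta^\star_h$ along $\pi$ such that $$\Big|\sum_{h=1}^H\mathbb E_{\pi'}\big[\langle\phi_h(S_h,A_h),\theta^\star_h\rangle-(\mathcal T_hQ')(S_h,A_h)\big]\Big|\le\varepsilon .$$ **Algorithm (S³Q-learning)** with controller $\pi$, bonus $b$, and regularization $\lambda>0$. Initially $Q^{tar}_h=0$ for $h\in\{1,\dots,H+1\}$. In epoch $e=1,2,\dots$, for levels $\ell=H,H-1,\dots,1$: set $\widehat\theta_\ell=0$, $\Sigma_\ell=\lambda I$; play $2^e$ independent trajectories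 of $\pi$, and after each one update at every stage $h$ $$\widehat\theta_h\leftarrow\widehat\theta_h+\frac{\Sigma_h^{-1}\phi_h\,\mathrm{td}_h}{1+\|\phi_h\|^2_{\Sigma_h^{-1}}},\qquad \Sigma_h^{-1}\leftarrow\Sigma_h^{-1}-\frac{\Sigma_h^{-1}\phi_h\phi_h^\top\Sigma_h^{-1}}{1+\|\phi_h\|^2_{\Sigma_h^{-1}}},\qquad \mathrm{td}_h=r_h+\max_{a'}Q^{tar}_{h+1}(s_{h+1},a')-\langle\phi_h,\widehat\theta_h\rangle ,$$ where $\phi_h=\phi_h(s_h,a_h)$ and the right-hand sides use the old values; then set $\theta^{tar}_\ell=\arg\min_{\theta\in\mathcal B}\|\theta-\widehat\theta_\ell\|^2_{\Sigma_\ell}$ and $Q^{tar}_\ell=\min\{1,\langle\phi_\ell,\theta^{tar}_\ell\rangle+b_\ell\}$. After level $1$ set $\widehat Q=Q^{tar}$ and begin the next epoch. When stopped after $K$ trajectories, the algorithm returns the current $\widehat Q$; let $e_{tot}$ be the number of completed epochs, so that $e_{tot}\ge1$ exactly when $K\ge 2H$. Put $\widehat V_1(s)=\max_a\widehat Q_1(s,a)$.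 **Uncertainty function.** For $c>0$ and $\delta\in(0,1)$ let $n^*=\frac{K}{4H}$, $\delta^*=\frac{\delta}{2He_{tot}^2d}$, $$U_h(s,a)=c\Big\{\sqrt{d\log\tfrac{d\,n^*\,\mathrm e\,H}{\delta^*}}+\sqrt\lambda\Big\}\,\|\phi_h(s,a)\|_{\left(n^*\mathbb E_\pi[\phi_h\phi_h^\top]+\lambda I\right)^{-1}},\qquad \mathrm e=\exp(1).$$ **Theorem.** There is a universal constant $c>0$ such that the following holds for every MDP and feature map as above that are $\varepsilon$-misspecified with respect to the low-rank condition over $\mathcal C$, every controller $\pi\in\mathcal C$, every measurable bonus $b\ge0$, every $\lambda>0$ and every $\delta\in(0,1)$. With probability at least $1-\delta$, simultaneously for all $K\ge 2H$ (hence also at any data-dependent stopping time), the output $\widehat Q$ of S³Q-learning stopped after $K$ trajectories satisfies: (a) for all $h\in\{1,\dots,H\}$, every best on-policy fit $\theta^\star_h$ along $\pi$ with $Q'=\widehat Q$, and all $(s,a)$, the Bellman error $\mathrm{err}_h=\widehat Q_h-\mathcal T_h\widehat Q$ and the comparator error $\Delta_h=\mathcal T_h\widehat Q-\langle\phi_h,\theta^\star_h\rangle$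 satisfy $$\min\{0,-U_h+b_h\}(s,a)\le(\mathrm{err}_h+\Delta_h)(s,a)\le(U_h+b_h)(s,a);$$ (b) every greedy policy $\bar\pi$, $\bar\pi_h(s)\in\arg\max_a\widehat Q_h(s,a)$, satisfies $$\mathbb E_{S\sim\rho}(\widehat V_1-V^*_1)(S)\le\mathbb E_{S\sim\rho}(\widehat V_1-V^{\bar\pi}_1)(S)\le\mathbb E_{\bar\pi}\sum_{h=1}^H(U_h+b_h)(S_h,A_h)+\varepsilon,$$ where the expectation on the right may be $+\infty$. -/

import Mathlib

open MeasureTheory ProbabilityTheory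
open scoped ENNReal

noncomputable section

namespace S3Q

universe u v

/-! ## Finite-horizon Markov decision processes

Stages are numbered `0, …, H - 1` (stage `h` here is stage `h + 1` in one-based numbering).
Objects indexed by a stage are indexed by `ℕ`; the data at stages `≥ H` are never used. -/

/-- One step of a trajectory: `((s, a), (r, s'))`, i.e. state, action, reward, next state. -/
abbrev Step (S : Type u) (A : Type v) : Type (max u v) := (S × A) × (ℝ × S)

/-- A finite-horizon MDP.  `step h (s, a)` is the joint law of the random reward and of the next
state when `a` is played in `s` at stage `h`; its two marginals are the reward distribution and the
transition probability. -/
structure MDP (S : Type u) (A : Type v) [MeasurableSpace S] [MeasurableSpace A] where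
  H : ℕ
  H_pos : 0 < H
  ρ : Measure S
  isProbabilityMeasure_ρ : IsProbabilityMeasure ρ
  step : ℕ → Kernel (S × A) (ℝ × S)
  isMarkovKernel_step : ∀ h, IsMarkovKernel (step h)

attribute [instance] MDP.isProbabilityMeasure_ρ MDP.isMarkovKernel_step

/-- A policy: for every stage a (measurable) map from states to actions. -/
structure Policy (S : Type u) (A : Type v) [MeasurableSpace S] [MeasurableSpace A] where
  act : ℕ → S → A
  measurable_act : ∀ h, Measurable (act h)

/-- A stationary controller: at the start of each episode it draws one of finitely many policies
from a fixed distribution and plays it for the whole episode.  A single policy is the case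
`m = 1`. -/
structure Controller (S : Type u) (A : Type v) [MeasurableSpace S] [MeasurableSpace A] where
  m : ℕ
  weight : PMF (Fin m)
  policy : Fin m → Policy S A

/-- A family of state-action functions, one for each stage. -/
abbrev QFun (S : Type u) (A : Type v) : Type (max u v) := ℕ → S → A → ℝ

/-- `V_h(s) = max_a Q_h(s, a)`. -/
def maxQ {S : Type u} {A : Type v} (Q : QFun S A) (h : ℕ) (s : S) : ℝ := ⨆ a, Q h s a

/-- `π` is a greedy policy for `Q` on the stages `0, …, H - 1`. -/
def IsGreedy {S : Type u} {A : Type v} [MeasurableSpace S] [MeasurableSpace A]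
    (H : ℕ) (Q : QFun S A) (π : Policy S A) : Prop :=
  ∀ h < H, ∀ s a, Q h s a ≤ Q h s (π.act h s)

namespace MDP

variable {S : Type u} {A : Type v} [MeasurableSpace S] [MeasurableSpace A] (M : MDP S A)

/-- A trajectory `(s_h, a_h, r_h, s_{h+1})`, `0 ≤ h < H`. -/
abbrev Traj : Type (max u v) := Fin M.H → Step S A

/-- The law of the step made by `π` at stage `h`, given the current state. -/
def stepKernel (π : Policy S A) (h : ℕ) : Kernel S (Step S A) :=
  Kernel.deterministic (fun s => (s, π.act h s)) (measurable_id.prodMk (π.measurable_act h)) ⊗ₖ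
    Kernel.prodMkLeft S (M.step h)

/-- The law of the `n` steps made by `π` at the stages `h, …, h + n - 1`, given the state at
stage `h`. -/
def pathKernel (π : Policy S A) : (n h : ℕ) → Kernel S (Fin n → Step S A)
  | 0, _ => Kernel.const S (Measure.dirac Fin.elim0)
  | n + 1, h =>
    (M.stepKernel π h ⊗ₖ
        (pathKernel π n (h + 1)).comap (fun q : S × Step S A => q.2.2.2) (by fun_prop)).map
      (fun q => (Fin.cons q.1 q.2 : Fin (n + 1) → Step S A))

/-- The law of the trajectory of `π` started from `ρ`. -/
def law (π : Policy S A) : Measure M.Traj := M.ρ.bind (M.pathKernel π M.H 0)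

/-- The law of an episode of a controller. -/
def controllerLaw (π : Controller S A) : Measure M.Traj :=
  ∑ i, π.weight i • M.law (π.policy i)

/-- `E f(S_h, A_h)` when the trajectory has law `μ`. -/
def expect (μ : Measure M.Traj) (h : Fin M.H) (f : S → A → ℝ) : ℝ :=
  ∫ τ, f (τ h).1.1 (τ h).1.2 ∂μ

/-- The random rewards are almost surely bounded by one in absolute value. -/
def BoundedRewards : Prop := ∀ h < M.H, ∀ s a, ∀ᵐ q ∂M.step h (s, a), |q.1| ≤ 1

/-- The mean reward `r_h(s, a)`. -/
def meanReward (h : ℕ) (s : S) (a : A) : ℝ := ∫ q, q.1 ∂M.step h (s, a)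

/-- The value function `V^π_h(s)`. -/
def value (π : Policy S A) (h : ℕ) (s : S) : ℝ :=
  ∫ τ, ∑ j : Fin (M.H - h), M.meanReward (h + j) (τ j).1.1 (τ j).1.2
    ∂M.pathKernel π (M.H - h) h s

/-- The optimal value function `V^*_h(s) = sup_π V^π_h(s)`. -/
def optValue (h : ℕ) (s : S) : ℝ := ⨆ π : Policy S A, M.value π h s

/-- The Bellman optimality operator
`(T_h Q)(s, a) = r_h(s, a) + E_{s' ∼ P_h(s, a)} max_{a'} Q_{h+1}(s', a')`. -/
def bellman (Q : QFun S A) (h : ℕ) (s : S) (a : A) : ℝ :=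
  M.meanReward h s a + ∫ q, maxQ Q (h + 1) q.2 ∂M.step h (s, a)

/-- The class of all (measurable) state-action functions with `|Q_h| ≤ 1` at every stage that
vanish at the stage after the last one. -/
def QAll : Set (QFun S A) :=
  {Q | (∀ h a, Measurable fun s => Q h s a) ∧ (∀ h s a, |Q h s a| ≤ 1) ∧ Q M.H = 0}

end MDP

/-! ## Linear function approximation -/

/-- A feature map: measurable, with Euclidean norm at most one. -/
structure Features (S : Type u) (A : Type v) [MeasurableSpace S] (d : ℕ) where
  φ : ℕ → S → A → EuclideanSpace ℝ (Fin d)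
  measurable_φ : ∀ h a, Measurable fun s => φ h s a
  norm_φ_le : ∀ h s a, ‖φ h s a‖ ≤ 1

/-- The linear function `⟨φ_h(s, a), θ⟩`. -/
def Features.lin {S : Type u} {A : Type v} [MeasurableSpace S] {d : ℕ} (F : Features S A d)
    (θ : EuclideanSpace ℝ (Fin d)) (h : ℕ) (s : S) (a : A) : ℝ :=
  inner ℝ (F.φ h s a) θ

/-- The Euclidean unit ball of parameters. -/
abbrev unitBall (d : ℕ) : Set (EuclideanSpace ℝ (Fin d)) := Metric.closedBall 0 1

/-- The quadratic form `‖x‖²_G = xᵀ G x`. -/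
def quad {d : ℕ} (G : Matrix (Fin d) (Fin d) ℝ) (x : EuclideanSpace ℝ (Fin d)) : ℝ :=
  x.ofLp ⬝ᵥ G.mulVec x.ofLp

section Misspecification

variable {S : Type u} {A : Type v} [MeasurableSpace S] [MeasurableSpace A]
  (M : MDP S A) {d : ℕ} (F : Features S A d)

/-- `θ` is a best on-policy fit at stage `h` along the controller `π`, with `Q` as next-stage
function: it minimizes `E_π (⟨φ_h, θ⟩ - T_h Q)²` over the unit ball. -/
def IsBestPredictor (π : Controller S A) (Q : QFun S A) (h : Fin M.H)
    (θ : EuclideanSpace ℝ (Fin d)) : Prop :=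
  θ ∈ unitBall d ∧
    IsMinOn (fun w => M.expect (M.controllerLaw π) h
      fun s a => (F.lin w h s a - M.bellman Q h s a) ^ 2) (unitBall d) θ

/-- `ε`-misspecification with respect to the low-rank condition, for data-generating controllers
in the class `C`: for all `π ∈ C`, all policies `π'` and all `Q` in the class of all bounded
functions, a best on-policy fit along `π` has average Bellman error at most `ε` along `π'`.
The minimizer need not be unique, and only one suitable choice is asked for. -/
def LowRankMisspecified (C : Set (Controller S A)) (ε : ℝ) : Prop :=
  ∀ π ∈ C, ∀ π' : Policy S A, ∀ Q ∈ M.QAll,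
    ∃ θ : Fin M.H → EuclideanSpace ℝ (Fin d),
      (∀ h, IsBestPredictor M F π Q h (θ h)) ∧
      |∑ h : Fin M.H, M.expect (M.law π') h
        fun s a => F.lin (θ h) h s a - M.bellman Q h s a| ≤ ε

/-- The regularized expected cumulative covariance `n E_π[φ_h φ_hᵀ] + lam I`. -/
def expectedCov (π : Controller S A) (lam n : ℝ) (h : Fin M.H) : Matrix (Fin d) (Fin d) ℝ :=
  n • Matrix.of (fun i j => M.expect (M.controllerLaw π) h
    fun s a => (F.φ h s a).ofLp i * (F.φ h s a).ofLp j) + lam • 1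

/-- The uncertainty parameter `α(n, δ) = c (√(d log(d n e H / δ)) + √lam)`, `e = exp 1`. -/
def uncertaintyParam (c : ℝ) (d H : ℕ) (lam n δ : ℝ) : ℝ :=
  c * (√(d * Real.log (d * n * Real.exp 1 * H / δ)) + √lam)

/-- The uncertainty function `U_h(s, a)` after `K` trajectories and `etot` completed epochs. -/
def uncertainty (π : Controller S A) (c lam δ : ℝ) (K etot : ℕ) (h : Fin M.H) (s : S) (a : A) :
    ℝ :=
  let n : ℝ := K / (4 * M.H)
  let δ' : ℝ := δ / (2 * M.H * etot ^ 2 * d)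
  uncertaintyParam c d M.H lam n δ' * √(quad (expectedCov M F π lam n h)⁻¹ (F.φ h s a))

/-- The Bellman error `Q_h - T_h Q_{h+1}`. -/
def bellmanError (Q : QFun S A) (h : ℕ) (s : S) (a : A) : ℝ := Q h s a - M.bellman Q h s a

/-- The comparator error `T_h Q_{h+1} - ⟨φ_h, θ⟩` of a best on-policy fit `θ`. -/
def comparatorError (Q : QFun S A) (h : ℕ) (θ : EuclideanSpace ℝ (Fin d)) (s : S) (a : A) : ℝ :=
  M.bellman Q h s a - F.lin θ h s a

end Misspecification

/-! ## The algorithm -/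

/-- The memory of the algorithm: epoch counter, current level, number of trajectories used at the
current level, network parameters and inverse covariances of all stages, target network, and best
approximator (the target network at the end of the last completed epoch). -/
structure State (S : Type u) (A : Type v) (d : ℕ) where
  epoch : ℕ
  level : ℕ
  count : ℕ
  θ : ℕ → EuclideanSpace ℝ (Fin d)
  covInv : ℕ → Matrix (Fin d) (Fin d) ℝ
  Qtar : QFun S A
  Qbest : QFun S A

section Algorithm

variable {S : Type u} {A : Type v} [MeasurableSpace S] [MeasurableSpace A]
  (M : MDP S A) {d : ℕ} (F : Features S A d) (b : QFun S A) (lam : ℝ)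

/-- Second-order update of a network parameter with feature vector `x` and temporal difference
error `td`. -/
def paramUpdate (θ : EuclideanSpace ℝ (Fin d)) (P : Matrix (Fin d) (Fin d) ℝ)
    (x : EuclideanSpace ℝ (Fin d)) (td : ℝ) : EuclideanSpace ℝ (Fin d) :=
  θ + (td / (1 + quad P x)) • WithLp.toLp 2 (P.mulVec x.ofLp)

/-- Sherman–Morrison update of an inverse covariance with feature vector `x`. -/
def covUpdate (P : Matrix (Fin d) (Fin d) ℝ) (x : EuclideanSpace ℝ (Fin d)) :
    Matrix (Fin d) (Fin d) ℝ :=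
  P - (1 / (1 + quad P x)) • Matrix.vecMulVec (P.mulVec x.ofLp) (P.vecMul x.ofLp)

/-- The temporal difference error `r + max_{a'} Q_{h+1}(s', a') - ⟨φ_h(s, a), θ⟩`. -/
def tdError (Q : QFun S A) (θ : EuclideanSpace ℝ (Fin d)) (h : ℕ) (x : Step S A) : ℝ :=
  x.2.1 + maxQ Q (h + 1) x.2.2 - F.lin θ h x.1.1 x.1.2

/-- Processing one trajectory: networks and covariances of all stages are updated. -/
def playTrajectory (st : State S A d) (τ : M.Traj) : State S A d :=
  { st with
    count := st.count + 1
    θ := fun h => if hh : h < M.H then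
        paramUpdate (st.θ h) (st.covInv h) (F.φ h (τ ⟨h, hh⟩).1.1 (τ ⟨h, hh⟩).1.2)
          (tdError F st.Qtar (st.θ h) h (τ ⟨h, hh⟩))
      else st.θ h
    covInv := fun h => if hh : h < M.H then
        covUpdate (st.covInv h) (F.φ h (τ ⟨h, hh⟩).1.1 (τ ⟨h, hh⟩).1.2)
      else st.covInv h }

/-- The projection of `θ` onto the unit ball in the norm of the covariance `G` (the minimizer
exists, and is unique when `G` is positive definite). -/
def project (G : Matrix (Fin d) (Fin d) ℝ) (θ : EuclideanSpace ℝ (Fin d)) :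
    EuclideanSpace ℝ (Fin d) :=
  Classical.epsilon fun w => w ∈ unitBall d ∧ IsMinOn (fun w' => quad G (w' - θ)) (unitBall d) w

/-- Move to level `l`: its network and covariance are initialized. -/
def startLevel (st : State S A d) (l : ℕ) : State S A d :=
  { st with
    level := l
    count := 0
    θ := Function.update st.θ l 0
    covInv := Function.update st.covInv l (lam • (1 : Matrix (Fin d) (Fin d) ℝ))⁻¹ }

/-- Update of the target network at the current level: the parameter is projected, the bonus is
added, and the sum is clipped at one. -/
def updateTarget (st : State S A d) : State S A d :=
  let w := project (st.covInv st.level)⁻¹ (st.θ st.level)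
  { st with
    Qtar := Function.update st.Qtar st.level
      fun s a => min 1 (F.lin w st.level s a + b st.level s a) }

/-- One round of the algorithm: a trajectory is processed; when the current level has used
`2 ^ epoch` trajectories, its target network is updated and the next lower level begins, or, after
the lowest level, the target network is saved and a new epoch begins. -/
def round (st : State S A d) (τ : M.Traj) : State S A d :=
  let st₁ := playTrajectory M F st τ
  if st₁.count < 2 ^ st₁.epoch then st₁
  else
    let st₂ := updateTarget F b st₁
    if st₂.level = 0 then
      startLevel lam { st₂ with epoch := st₂.epoch + 1, Qbest := st₂.Qtar } (M.H - 1)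
    else startLevel lam st₂ (st₂.level - 1)

/-- The initial state: first epoch, top level, zero target network. -/
def initState : State S A d :=
  startLevel lam
    { epoch := 1, level := 0, count := 0, θ := 0, covInv := 0, Qtar := 0, Qbest := 0 } (M.H - 1)

/-- The state after the first `K` trajectories of the stream `x`. -/
def run (x : ℕ → M.Traj) : ℕ → State S A d
  | 0 => initState M lam
  | K + 1 => round M F b lam (run x K) (x K)

/-- The predictor returned by the algorithm when it is stopped after `K` trajectories. -/
def output (x : ℕ → M.Traj) (K : ℕ) : QFun S A := (run M F b lam x K).Qbest

/-- The number of epochs completed after `K` trajectories. -/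
def epochsCompleted (x : ℕ → M.Traj) (K : ℕ) : ℕ := (run M F b lam x K).epoch - 1

end Algorithm

end S3Q

end

/-! The controller never changes, so the trajectories are i.i.d., and level `h` of epoch `e` is a
ridge regression over the unit ball on `2 ^ e` of them, with labels r + max Q_{h+1}. The recursive
updates maintain the normal equations of this regression, and projecting their solution in the
covariance norm minimizes the regularized loss over the ball (`quad_sub_eq_ridgeLoss`). Since a
level alters only its own entry of the target, the saved output solves all `H` regressions of the
last completed epoch simultaneously (`output_spec`).

The labels depend on the next-stage target, which is itself random. That target is determined by a
parameter in the unit ball, on which the label depends in a Lipschitz way. So no conditioning on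
earlier levels is needed: the deviation inequality `exists_event_excessLoss_le` is uniform over the
label parameter and over the two competing regression parameters. Uniformity is obtained without a
net. The exponential of the centred sum is averaged over the ball of parameter triples, Markov's
inequality bounds this average, and a shrunken copy of the ball around any given point converts the
average into a pointwise bound, at the price of 3d log n.

The rate is fast although the model may be misspecified. The second moment of the excess squared
loss over a best fit is at most 36 E⟨φ, w - θ⋆⟩², while minimality of θ⋆ over a convex set makes the
mean excess at least E⟨φ, w - θ⋆⟩² (`integral_sq_le_of_isMinOn`). Half of this lower bound absorbs
the variance, and optimality of the ridge solution bounds the empirical excess by λ. Hence 2^e E⟨φ,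
w - θ⋆⟩² is of order λ + d log(2^e) + log(1/t) outside an event of probability t. A union bound over
epochs and levels covers all `K` at once. Cauchy–Schwarz in the norm of the regularized expected
covariance then gives |⟨φ, w - θ⋆⟩| ≤ U pointwise, because K/(4H) is comparable to the sample size
`2 ^ e`.

Claim (a) follows since the Bellman backup cancels: err + Δ = min(1, ⟨φ, w⟩ + b) - ⟨φ, θ⋆⟩. For (b),
the gap between predicted and true value of a greedy policy is the expected sum of its Bellman
errors. Adding and subtracting Δ leaves err + Δ ≤ U + b and a sum of -Δ, whose expectation is
exactly what the low-rank condition controls. -/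

noncomputable section

namespace S3Q

/-! ### Uniform deviation inequality for excess squared losses -/

section Concentration

open Metric Module

/-- Volume comparison: if the exponential of a Lipschitz function has a small average over the unit
ball, then the function is small everywhere on the ball, up to a dimension term. -/
theorem le_of_lintegral_exp_le {V : Type*} [NormedAddCommGroup V] [NormedSpace ℝ V]
    [FiniteDimensional ℝ V] [MeasurableSpace V] [BorelSpace V] (μ : Measure V)
    [μ.IsAddHaarMeasure] {f : V → ℝ} {n : ℕ} (hn : 0 < n)
    (hf : ∀ p ∈ closedBall (0 : V) 1, ∀ q ∈ closedBall (0 : V) 1, f p - f q ≤ n * ‖q - p‖)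
    {t : ℝ} (ht : 0 < t)
    (h : ∫⁻ p in closedBall (0 : V) 1, ENNReal.ofReal (Real.exp (f p)) ∂μ ≤
      ENNReal.ofReal t⁻¹ * μ (closedBall (0 : V) 1)) {p : V} (hp : p ∈ closedBall (0 : V) 1) :
    f p ≤ 2 + finrank ℝ V * Real.log n + Real.log t⁻¹ := by
  set K := closedBall (0 : V) 1 with hKdef
  have hn' : (0 : ℝ) < n := by exact_mod_cast hn
  have hn1 : (1 : ℝ) ≤ n := by exact_mod_cast hn
  have hKc : IsCompact K := isCompact_closedBall 0 1
  have hK0 : μ K ≠ 0 := (measure_closedBall_pos μ 0 one_pos).ne'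
  have hKt : μ K ≠ ∞ := hKc.measure_lt_top.ne
  -- Contracting the ball towards `p` with ratio 1/n keeps it inside the ball and within distance
  -- 2/n of `p`. There `f` drops by at most 2, and the volume shrinks only by n to the power of the
  -- dimension.
  set r : ℝ := (n : ℝ)⁻¹ with hr
  have hr0 : 0 < r := inv_pos.2 hn'
  have hr1 : r ≤ 1 := inv_le_one_of_one_le₀ hn1
  set K' := AffineMap.homothety p r '' K with hK'
  have hK'c : IsCompact K' := hKc.image
    (AffineMap.homothety_continuous p r)
  have hsub : ∀ q ∈ K', q ∈ K ∧ ‖q - p‖ ≤ 2 * r := by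
    rintro q ⟨q₀, hq₀, rfl⟩
    rw [hKdef, mem_closedBall_zero_iff] at hq₀ hp
    have e : AffineMap.homothety p r q₀ = (1 - r) • p + r • q₀ := by
      rw [AffineMap.homothety_apply]
      simp only [vsub_eq_sub, vadd_eq_add]
      module
    refine ⟨?_, ?_⟩
    · rw [e, hKdef, mem_closedBall_zero_iff]
      calc ‖(1 - r) • p + r • q₀‖ ≤ ‖(1 - r) • p‖ + ‖r • q₀‖ := norm_add_le _ _
        _ = (1 - r) * ‖p‖ + r * ‖q₀‖ := by
          rw [norm_smul, norm_smul, Real.norm_of_nonneg (by linarith), Real.norm_of_nonneg hr0.le]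
        _ ≤ (1 - r) * 1 + r * 1 := by gcongr
        _ = 1 := by ring
    · have : AffineMap.homothety p r q₀ - p = r • (q₀ - p) := by rw [e]; module
      rw [this, norm_smul, Real.norm_of_nonneg hr0.le, mul_comm]
      gcongr
      calc ‖q₀ - p‖ ≤ ‖q₀‖ + ‖p‖ := norm_sub_le _ _
        _ ≤ 2 := by linarith
  have hvol : μ K' = ENNReal.ofReal (r ^ finrank ℝ V) * μ K := by
    rw [hK', Measure.addHaar_image_homothety, abs_of_pos (by positivity)]
  have hlow : ENNReal.ofReal (Real.exp (f p - 2)) * μ K' ≤ ENNReal.ofReal t⁻¹ * μ K := by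
    calc ENNReal.ofReal (Real.exp (f p - 2)) * μ K'
        = ∫⁻ _ in K', ENNReal.ofReal (Real.exp (f p - 2)) ∂μ := by
          rw [setLIntegral_const]
      _ ≤ ∫⁻ q in K', ENNReal.ofReal (Real.exp (f q)) ∂μ := by
          refine setLIntegral_mono' hK'c.measurableSet fun q hq => ?_
          obtain ⟨h1, h2⟩ := hsub q hq
          gcongr
          have h3 := hf p hp q h1
          have h4 : (n : ℝ) * ‖q - p‖ ≤ n * (2 * r) := by gcongr
          have h5 : (n : ℝ) * (2 * r) = 2 := by rw [hr]; field_simp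
          linarith
      _ ≤ ∫⁻ q in K, ENNReal.ofReal (Real.exp (f q)) ∂μ :=
          lintegral_mono_set fun q hq => (hsub q hq).1
      _ ≤ _ := h
  rw [hvol, ← mul_assoc, ENNReal.mul_le_mul_iff_left hK0 hKt, ← ENNReal.ofReal_mul (by positivity),
    ENNReal.ofReal_le_ofReal_iff (by positivity)] at hlow
  have h6 := Real.log_le_log (by positivity) hlow
  rw [Real.log_mul (by positivity) (by positivity), Real.log_exp, Real.log_pow, hr, Real.log_inv]
    at h6
  linarith

/-- Markov's inequality for the average over the unit ball of an exponential of a sum of independent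
variables whose exponential moments are at most one. -/
theorem exists_event_lintegral_exp_sum_le {V X Ω : Type*} [NormedAddCommGroup V] [NormedSpace ℝ V]
    [FiniteDimensional ℝ V] [MeasurableSpace V] [BorelSpace V] (μ : Measure V)
    [μ.IsAddHaarMeasure] [MeasurableSpace X] [MeasurableSpace Ω] (P : Measure Ω)
    [IsProbabilityMeasure P] (ν : Measure X) {g : V → X → ℝ} (hg : Measurable (Function.uncurry g))
    (hexp : ∀ p ∈ closedBall (0 : V) 1, ∫⁻ x, ENNReal.ofReal (Real.exp (g p x)) ∂ν ≤ 1)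
    {n : ℕ} {ξ : Fin n → Ω → X} (hξ : ∀ i, Measurable (ξ i)) (hind : iIndepFun ξ P)
    (hlaw : ∀ i, P.map (ξ i) = ν) {t : ℝ} (ht : 0 < t) :
    ∃ T : Set Ω, MeasurableSet T ∧ P Tᶜ ≤ ENNReal.ofReal t ∧ ∀ ω ∈ T,
      ∫⁻ p in closedBall (0 : V) 1, ENNReal.ofReal (Real.exp (∑ i, g p (ξ i ω))) ∂μ ≤
        ENNReal.ofReal t⁻¹ * μ (closedBall (0 : V) 1) := by
  set K := closedBall (0 : V) 1 with hKdef
  have hKc : IsCompact K := isCompact_closedBall 0 1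
  have hK0 : μ K ≠ 0 := (measure_closedBall_pos μ 0 one_pos).ne'
  have hKt : μ K ≠ ∞ := hKc.measure_lt_top.ne
  have hG : Measurable fun q : Ω × V =>
      ENNReal.ofReal (Real.exp (∑ i, g q.2 (ξ i q.1))) := by
    refine ENNReal.measurable_ofReal.comp (Real.measurable_exp.comp ?_)
    refine Finset.measurable_sum _ fun i _ => ?_
    exact hg.comp (measurable_snd.prodMk ((hξ i).comp measurable_fst))
  have hGm : Measurable fun ω => ∫⁻ p in K,
      ENNReal.ofReal (Real.exp (∑ i, g p (ξ i ω))) ∂μ := hG.lintegral_prod_right'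
  -- By Tonelli the expectation may be taken for fixed `p`, where independence splits it into
  -- factors that are at most one.
  have hmean : ∫⁻ ω, ∫⁻ p in K, ENNReal.ofReal (Real.exp (∑ i, g p (ξ i ω))) ∂μ ∂P ≤ μ K := by
    rw [lintegral_lintegral_swap hG.aemeasurable]
    calc ∫⁻ p in K, ∫⁻ ω, ENNReal.ofReal (Real.exp (∑ i, g p (ξ i ω))) ∂P ∂μ
        ≤ ∫⁻ p in K, 1 ∂μ := by
          refine setLIntegral_mono' hKc.measurableSet fun p hp => ?_
          have hgp : Measurable fun x => ENNReal.ofReal (Real.exp (g p x)) :=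
            ENNReal.measurable_ofReal.comp (Real.measurable_exp.comp
              (hg.comp (measurable_const.prodMk measurable_id)))
          have hprod : ∀ ω, ENNReal.ofReal (Real.exp (∑ i, g p (ξ i ω))) =
              ∏ i, ENNReal.ofReal (Real.exp (g p (ξ i ω))) := fun ω => by
            rw [Real.exp_sum, ENNReal.ofReal_prod_of_nonneg fun i _ => (Real.exp_pos _).le]
          simp_rw [hprod]
          have hi := hind.comp (fun _ x => ENNReal.ofReal (Real.exp (g p x))) (fun _ => hgp)
          have h1 := lintegral_prod_eq_prod_lintegral_of_indepFun Finset.univ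
            (fun i ω => ENNReal.ofReal (Real.exp (g p (ξ i ω)))) hi
            (fun i => hgp.comp (hξ i))
          rw [h1]
          refine Finset.prod_le_one' fun i _ => ?_
          have h2 : ∫⁻ ω, ENNReal.ofReal (Real.exp (g p (ξ i ω))) ∂P =
              ∫⁻ x, ENNReal.ofReal (Real.exp (g p x)) ∂ν := by
            rw [← hlaw i, lintegral_map hgp (hξ i)]
          rw [h2]
          exact hexp p hp
      _ = μ K := by simp
  refine ⟨_, measurableSet_le hGm measurable_const, ?_, fun ω hω => hω⟩
  have ht0 : ENNReal.ofReal t⁻¹ * μ K ≠ 0 :=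
    mul_ne_zero (by simpa using ht) hK0
  have htt : ENNReal.ofReal t⁻¹ * μ K ≠ ∞ := ENNReal.mul_ne_top ENNReal.ofReal_ne_top hKt
  have hmk := meas_ge_le_lintegral_div hGm.aemeasurable (μ := P) ht0 htt
  calc P {ω | ∫⁻ p in K, ENNReal.ofReal (Real.exp (∑ i, g p (ξ i ω))) ∂μ ≤
          ENNReal.ofReal t⁻¹ * μ K}ᶜ
      ≤ P {ω | ENNReal.ofReal t⁻¹ * μ K ≤
          ∫⁻ p in K, ENNReal.ofReal (Real.exp (∑ i, g p (ξ i ω))) ∂μ} := by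
        refine measure_mono fun ω hω => ?_
        simp only [Set.mem_compl_iff, Set.mem_ofPred_eq, not_le] at hω ⊢
        exact hω.le
    _ ≤ _ := hmk
    _ ≤ μ K / (ENNReal.ofReal t⁻¹ * μ K) := by gcongr
    _ = ENNReal.ofReal t := by
        rw [ENNReal.ofReal_inv_of_pos ht]
        have hto : ENNReal.ofReal t ≠ 0 := by simpa using ht
        rw [ENNReal.div_eq_inv_mul, ENNReal.mul_inv (Or.inr hKt) (Or.inr hK0), inv_inv, mul_assoc,
          ENNReal.inv_mul_cancel hK0 hKt, mul_one]

/-- Exponential moment of a centred bounded variable. -/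
theorem lintegral_exp_sub_le_one {X : Type*} [MeasurableSpace X] (ν : Measure X)
    [IsProbabilityMeasure ν] {D : X → ℝ} (hD : Measurable D) {B : ℝ} {η : ℝ} (hB : ∀ x, |D x| ≤ B)
    (hη : 0 < η) (hηB : η * B ≤ 1) :
    ∫⁻ x, ENNReal.ofReal (Real.exp (η * (∫ x, D x ∂ν) - η * D x - η ^ 2 * ∫ x, D x ^ 2 ∂ν)) ∂ν
      ≤ 1 := by
  have hi1 : Integrable D ν := .of_bound hD.aestronglyMeasurable B (ae_of_all _ hB)
  have hi2 : Integrable (fun x => D x ^ 2) ν :=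
    .of_bound (hD.pow_const 2).aestronglyMeasurable (B ^ 2) (ae_of_all _ fun x => by
      rw [Real.norm_of_nonneg (sq_nonneg _)]
      exact sq_le_sq' (by linarith [neg_abs_le (D x), hB x]) ((le_abs_self _).trans (hB x)))
  set m := ∫ x, D x ∂ν
  set s := ∫ x, D x ^ 2 ∂ν
  -- This is exp(u) ≤ 1 + u + u² for |u| ≤ 1, with u = -ηD.
  have key : ∀ x, Real.exp (η * m - η * D x - η ^ 2 * s) ≤
      Real.exp (η * m - η ^ 2 * s) * (1 - η * D x + η ^ 2 * D x ^ 2) := fun x => by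
    have h1 : η * m - η * D x - η ^ 2 * s = (η * m - η ^ 2 * s) + (-(η * D x)) := by ring
    rw [h1, Real.exp_add]
    gcongr
    have h2 : |-(η * D x)| ≤ 1 := by
      rw [abs_neg, abs_mul, abs_of_pos hη]
      exact (mul_le_mul_of_nonneg_left (hB x) hη.le).trans hηB
    have h3 := (abs_le.1 (Real.abs_exp_sub_one_sub_id_le h2)).2
    nlinarith
  have hint : Integrable
      (fun x => Real.exp (η * m - η ^ 2 * s) * (1 - η * D x + η ^ 2 * D x ^ 2)) ν :=
    (((integrable_const 1).sub (hi1.const_mul η)).add (hi2.const_mul (η ^ 2))).const_mul _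
  calc ∫⁻ x, ENNReal.ofReal (Real.exp (η * m - η * D x - η ^ 2 * s)) ∂ν
      ≤ ∫⁻ x, ENNReal.ofReal
          (Real.exp (η * m - η ^ 2 * s) * (1 - η * D x + η ^ 2 * D x ^ 2)) ∂ν :=
        lintegral_mono fun x => ENNReal.ofReal_le_ofReal (key x)
    _ = ENNReal.ofReal (∫ x, Real.exp (η * m - η ^ 2 * s) *
          (1 - η * D x + η ^ 2 * D x ^ 2) ∂ν) := by
        rw [ofReal_integral_eq_lintegral_ofReal hint
          (ae_of_all _ fun x => (Real.exp_pos _).le.trans (key x))]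
    _ ≤ 1 := by
        rw [← ENNReal.ofReal_one]
        refine ENNReal.ofReal_le_ofReal ?_
        have h5 : ∫ x, (1 - η * D x + η ^ 2 * D x ^ 2) ∂ν = 1 - η * m + η ^ 2 * s := by
          have h6 : Integrable (fun x => 1 - η * D x) ν :=
            (integrable_const 1).sub (hi1.const_mul η)
          rw [integral_add h6 (hi2.const_mul (η ^ 2)),
            integral_sub (integrable_const 1) (hi1.const_mul η), integral_const_mul,
            integral_const_mul]
          simp [m, s]
        rw [integral_const_mul, h5]
        -- The linearized mean is again below an exponential, by 1 + u ≤ exp(u), and this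
        -- exponential cancels the prefactor.
        have h4 : 1 - η * m + η ^ 2 * s ≤ Real.exp (-(η * m - η ^ 2 * s)) := by
          have := Real.add_one_le_exp (-(η * m - η ^ 2 * s)); linarith
        calc _ ≤ Real.exp (η * m - η ^ 2 * s) * Real.exp (-(η * m - η ^ 2 * s)) := by gcongr
          _ = 1 := by rw [← Real.exp_add]; simp

/-- The excess of the squared loss of `p.2.1` over that of `p.2.2`, when the label is `Y p.1`. -/
def excessLoss {X : Type*} {d : ℕ} (φ : X → EuclideanSpace ℝ (Fin d))
    (Y : EuclideanSpace ℝ (Fin d) → X → ℝ)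
    (p : EuclideanSpace ℝ (Fin d) × EuclideanSpace ℝ (Fin d) × EuclideanSpace ℝ (Fin d)) (x : X) :
    ℝ :=
  (inner ℝ (φ x) p.2.1 - Y p.1 x) ^ 2 - (inner ℝ (φ x) p.2.2 - Y p.1 x) ^ 2

section ExcessLoss

variable {X : Type*} {d : ℕ} {φ : X → EuclideanSpace ℝ (Fin d)}
  {Y : EuclideanSpace ℝ (Fin d) → X → ℝ}

theorem abs_inner_feature_le (hφ : ∀ x, ‖φ x‖ ≤ 1) (x : X) (v : EuclideanSpace ℝ (Fin d)) :
    |inner ℝ (φ x) v| ≤ ‖v‖ :=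
  (abs_real_inner_le_norm _ _).trans (mul_le_of_le_one_left (norm_nonneg _) (hφ x))

/-- The difference of squares factors, and the factor other than the prediction gap is at most 1 + 1
+ 2·2. A bound proportional to the gap, rather than a constant one, is what lets the variance be
absorbed later. -/
theorem abs_excessLoss_le (hφ : ∀ x, ‖φ x‖ ≤ 1) (hY : ∀ w ∈ unitBall d, ∀ x, |Y w x| ≤ 2)
    {w θ θ' : EuclideanSpace ℝ (Fin d)} (hw : w ∈ unitBall d) (hθ : θ ∈ unitBall d)
    (hθ' : θ' ∈ unitBall d) (x : X) :
    |excessLoss φ Y (w, θ, θ') x| ≤ 6 * |inner ℝ (φ x) (θ - θ')| := by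
  rw [mem_closedBall_zero_iff] at hθ hθ'
  have h1 := (abs_inner_feature_le hφ x θ).trans hθ
  have h2 := (abs_inner_feature_le hφ x θ').trans hθ'
  have h3 := hY w hw x
  have e : excessLoss φ Y (w, θ, θ') x = (inner ℝ (φ x) θ + inner ℝ (φ x) θ' - 2 * Y w x) *
      inner ℝ (φ x) (θ - θ') := by
    rw [inner_sub_right]; simp only [excessLoss]; ring
  rw [e, abs_mul]
  gcongr
  rw [abs_le] at *
  constructor <;> linarith

/-- Regularity for the volume comparison, in the sup norm of the triple. Each square changes by at
most 6·2r: the sum of the two residuals is at most 6 and their difference at most 2r. -/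
theorem abs_excessLoss_sub_le (hφ : ∀ x, ‖φ x‖ ≤ 1) (hY : ∀ w ∈ unitBall d, ∀ x, |Y w x| ≤ 2)
    (hlip : ∀ w w' x, |Y w x - Y w' x| ≤ ‖w - w'‖)
    {p q : EuclideanSpace ℝ (Fin d) × EuclideanSpace ℝ (Fin d) × EuclideanSpace ℝ (Fin d)}
    (hp : p ∈ closedBall 0 1) (hq : q ∈ closedBall 0 1) (x : X) :
    |excessLoss φ Y p x - excessLoss φ Y q x| ≤ 24 * ‖q - p‖ := by
  obtain ⟨w, θ, θ'⟩ := p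
  obtain ⟨w₁, θ₁, θ₁'⟩ := q
  simp only [mem_closedBall_zero_iff, Prod.norm_mk, sup_le_iff] at hp hq
  have hn1 : ‖w - w₁‖ ≤ ‖(w₁, θ₁, θ₁') - (w, θ, θ')‖ := by
    rw [norm_sub_rev]; exact le_max_left _ _
  have hn2 : ‖θ - θ₁‖ ≤ ‖(w₁, θ₁, θ₁') - (w, θ, θ')‖ := by
    rw [norm_sub_rev]; exact (le_max_left _ _).trans (le_max_right _ _)
  have hn3 : ‖θ' - θ₁'‖ ≤ ‖(w₁, θ₁, θ₁') - (w, θ, θ')‖ := by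
    rw [norm_sub_rev]; exact (le_max_right _ _).trans (le_max_right _ _)
  set r := ‖(w₁, θ₁, θ₁') - (w, θ, θ')‖
  have sq_bound : ∀ θ θ₁ : EuclideanSpace ℝ (Fin d), ‖θ‖ ≤ 1 → ‖θ₁‖ ≤ 1 → ‖θ - θ₁‖ ≤ r →
      |(inner ℝ (φ x) θ - Y w x) ^ 2 - (inner ℝ (φ x) θ₁ - Y w₁ x) ^ 2| ≤ 12 * r := by
    intro θ θ₁ h1 h2 h3
    have a1 := (abs_inner_feature_le hφ x θ).trans h1
    have a2 := (abs_inner_feature_le hφ x θ₁).trans h2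
    have a3 := hY w (mem_closedBall_zero_iff.2 hp.1) x
    have a4 := hY w₁ (mem_closedBall_zero_iff.2 hq.1) x
    have a5 := (abs_inner_feature_le hφ x (θ - θ₁)).trans h3
    have a6 := (hlip w w₁ x).trans hn1
    rw [inner_sub_right] at a5
    have e : (inner ℝ (φ x) θ - Y w x) ^ 2 - (inner ℝ (φ x) θ₁ - Y w₁ x) ^ 2 =
        (inner ℝ (φ x) θ + inner ℝ (φ x) θ₁ - Y w x - Y w₁ x) *
          ((inner ℝ (φ x) θ - inner ℝ (φ x) θ₁) - (Y w x - Y w₁ x)) := by ring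
    have b1 : |inner ℝ (φ x) θ + inner ℝ (φ x) θ₁ - Y w x - Y w₁ x| ≤ 6 := by
      rw [abs_le] at *; constructor <;> linarith
    have b2 : |(inner ℝ (φ x) θ - inner ℝ (φ x) θ₁) - (Y w x - Y w₁ x)| ≤ 2 * r := by
      rw [abs_le] at *; constructor <;> linarith
    rw [e, abs_mul]
    calc _ ≤ 6 * (2 * r) := mul_le_mul b1 b2 (abs_nonneg _) (by norm_num)
      _ = 12 * r := by ring
  have s1 := sq_bound θ θ₁ hp.2.1 hq.2.1 hn2
  have s2 := sq_bound θ' θ₁' hp.2.2 hq.2.2 hn3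
  simp only [excessLoss]
  rw [abs_le] at *
  constructor <;> linarith

variable [MeasurableSpace X]

theorem measurable_uncurry_excessLoss (hφm : Measurable φ) (hYm : Measurable (Function.uncurry Y)) :
    Measurable (Function.uncurry (excessLoss φ Y)) := by
  have h1 : Measurable fun q : (EuclideanSpace ℝ (Fin d) × EuclideanSpace ℝ (Fin d) ×
      EuclideanSpace ℝ (Fin d)) × X => Y q.1.1 q.2 :=
    hYm.comp ((measurable_fst.comp measurable_fst).prodMk measurable_snd)
  have h2 : Measurable fun q : (EuclideanSpace ℝ (Fin d) × EuclideanSpace ℝ (Fin d) ×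
      EuclideanSpace ℝ (Fin d)) × X => φ q.2 := hφm.comp measurable_snd
  have h3 : Measurable fun q : (EuclideanSpace ℝ (Fin d) × EuclideanSpace ℝ (Fin d) ×
      EuclideanSpace ℝ (Fin d)) × X => (inner ℝ (φ q.2) q.1.2.1 : ℝ) :=
    h2.inner (measurable_fst.comp (measurable_snd.comp measurable_fst))
  have h4 : Measurable fun q : (EuclideanSpace ℝ (Fin d) × EuclideanSpace ℝ (Fin d) ×
      EuclideanSpace ℝ (Fin d)) × X => (inner ℝ (φ q.2) q.1.2.2 : ℝ) :=
    h2.inner (measurable_snd.comp (measurable_snd.comp measurable_fst))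
  exact ((h3.sub h1).pow_const 2).sub ((h4.sub h1).pow_const 2)

/-- A uniform deviation inequality for excess squared losses: it holds simultaneously for all
labels in a parametric family and for all pairs of parameters. -/
theorem exists_event_excessLoss_le {Ω : Type*} [MeasurableSpace Ω] (P : Measure Ω)
    [IsProbabilityMeasure P] (ν : Measure X) [IsProbabilityMeasure ν] (hφm : Measurable φ)
    (hφ : ∀ x, ‖φ x‖ ≤ 1) (hYm : Measurable (Function.uncurry Y))
    (hY : ∀ w ∈ unitBall d, ∀ x, |Y w x| ≤ 2) (hlip : ∀ w w' x, |Y w x - Y w' x| ≤ ‖w - w'‖)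
    {n : ℕ} (hn : 0 < n) {ξ : Fin n → Ω → X} (hξ : ∀ i, Measurable (ξ i)) (hind : iIndepFun ξ P)
    (hlaw : ∀ i, P.map (ξ i) = ν) {t : ℝ} (ht : 0 < t) :
    ∃ T : Set Ω, MeasurableSet T ∧ P Tᶜ ≤ ENNReal.ofReal t ∧ ∀ ω ∈ T,
      ∀ w ∈ unitBall d, ∀ θ ∈ unitBall d, ∀ θ' ∈ unitBall d,
        n * (∫ x, excessLoss φ Y (w, θ, θ') x ∂ν - (∫ x, inner ℝ (φ x) (θ - θ') ^ 2 ∂ν) / 2) ≤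
          ∑ i, excessLoss φ Y (w, θ, θ') (ξ i ω) +
            72 * (2 + 3 * d * Real.log n + Real.log t⁻¹) := by
  set V := EuclideanSpace ℝ (Fin d) × EuclideanSpace ℝ (Fin d) × EuclideanSpace ℝ (Fin d)
  set D : V → X → ℝ := excessLoss φ Y with hDdef
  have hDm : Measurable (Function.uncurry D) := measurable_uncurry_excessLoss hφm hYm
  have hDp : ∀ p, Measurable (D p) := fun p => hDm.of_uncurry_left
  have hmem : ∀ p : V, p ∈ closedBall (0 : V) 1 ↔
      p.1 ∈ unitBall d ∧ p.2.1 ∈ unitBall d ∧ p.2.2 ∈ unitBall d := fun p => by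
    simp only [mem_closedBall_zero_iff]
    exact sup_le_iff.trans (and_congr_right fun _ => sup_le_iff)
  have hD12 : ∀ p ∈ closedBall (0 : V) 1, ∀ x, |D p x| ≤ 12 := fun p hp x => by
    obtain ⟨h1, h2, h3⟩ := (hmem p).1 hp
    have h4 := abs_excessLoss_le hφ hY h1 h2 h3 x
    have h5 := abs_inner_feature_le hφ x (p.2.1 - p.2.2)
    rw [mem_closedBall_zero_iff] at h2 h3
    have h6 := norm_sub_le p.2.1 p.2.2
    calc |D p x| ≤ _ := h4
      _ ≤ 12 := by linarith
  have hint : ∀ p ∈ closedBall (0 : V) 1, Integrable (D p) ν := fun p hp =>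
    .of_bound (hDp p).aestronglyMeasurable 12 (ae_of_all _ (hD12 p hp))
  have hint2 : ∀ p ∈ closedBall (0 : V) 1, Integrable (fun x => D p x ^ 2) ν := fun p hp =>
    .of_bound ((hDp p).pow_const 2).aestronglyMeasurable (12 ^ 2) (ae_of_all _ fun x => by
      rw [Real.norm_of_nonneg (sq_nonneg _)]
      exact sq_le_sq' (by linarith [neg_abs_le (D p x), hD12 p hp x])
        ((le_abs_self _).trans (hD12 p hp x)))
  set m : V → ℝ := fun p => ∫ x, D p x ∂ν
  set s : V → ℝ := fun p => ∫ x, D p x ^ 2 ∂ν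
  have hmm : Measurable m := (hDm.stronglyMeasurable.integral_prod_right).measurable
  have hsm : Measurable s := ((hDm.pow_const 2).stronglyMeasurable.integral_prod_right
    (f := fun p x => D p x ^ 2)).measurable
  -- The scale η = 1/72 is chosen because the second moment is at most 36 E⟨φ, θ - θ'⟩², so η times
  -- it is at most one half of E⟨φ, θ - θ'⟩². Also η·12 ≤ 1, as the exponential moment bound
  -- requires.
  set g : V → X → ℝ := fun p x => 1 / 72 * m p - 1 / 72 * D p x - (1 / 72) ^ 2 * s p
  have hgm : Measurable (Function.uncurry g) :=
    ((((hmm.comp measurable_fst).const_mul _).sub (hDm.const_mul _)).sub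
      ((hsm.comp measurable_fst).const_mul _))
  obtain ⟨T, hTm, hTP, hT⟩ := exists_event_lintegral_exp_sum_le (Measure.addHaar : Measure V) P ν hgm
    (fun p hp => lintegral_exp_sub_le_one ν (hDp p) (hD12 p hp) (by norm_num) (by norm_num))
    hξ hind hlaw ht
  refine ⟨T, hTm, hTP, fun ω hω w hw θ hθ θ' hθ' => ?_⟩
  -- The three terms contribute 24/72 + 24/72 + 576/72² = 7/9 ≤ 1, so the sum over the sample is
  -- n-Lipschitz.
  have hglip : ∀ p ∈ closedBall (0 : V) 1, ∀ q ∈ closedBall (0 : V) 1, ∀ x,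
      g p x - g q x ≤ ‖q - p‖ := by
    intro p hp q hq x
    have h1 : ∀ x, |D p x - D q x| ≤ 24 * ‖q - p‖ :=
      abs_excessLoss_sub_le hφ hY hlip hp hq
    have h2 : m p - m q ≤ 24 * ‖q - p‖ := by
      rw [← integral_sub (hint p hp) (hint q hq)]
      calc ∫ x, (D p x - D q x) ∂ν ≤ ∫ _, 24 * ‖q - p‖ ∂ν :=
            integral_mono ((hint p hp).sub (hint q hq)) (integrable_const _)
              fun x => (le_abs_self _).trans (h1 x)
        _ = _ := by simp
    have h3 : s q - s p ≤ 24 * (24 * ‖q - p‖) := by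
      rw [← integral_sub (hint2 q hq) (hint2 p hp)]
      calc ∫ x, (D q x ^ 2 - D p x ^ 2) ∂ν ≤ ∫ _, 24 * (24 * ‖q - p‖) ∂ν := by
            refine integral_mono ((hint2 q hq).sub (hint2 p hp)) (integrable_const _) fun x => ?_
            have e : D q x ^ 2 - D p x ^ 2 = -(D q x + D p x) * (D p x - D q x) := by ring
            show D q x ^ 2 - D p x ^ 2 ≤ _
            rw [e]
            refine (le_abs_self _).trans ?_
            rw [abs_mul, abs_neg]
            refine mul_le_mul ?_ (h1 x) (abs_nonneg _) (by norm_num)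
            exact (abs_add_le _ _).trans (by linarith [hD12 p hp x, hD12 q hq x])
        _ = _ := by simp
    have h4 := (abs_le.1 (h1 x)).1
    have h5 := norm_nonneg (q - p)
    simp only [g]
    linarith
  have hfin := le_of_lintegral_exp_le (Measure.addHaar : Measure V)
    (f := fun p => ∑ i, g p (ξ i ω)) hn (fun p hp q hq => by
      rw [← Finset.sum_sub_distrib]
      calc ∑ i, (g p (ξ i ω) - g q (ξ i ω)) ≤ ∑ _i : Fin n, ‖q - p‖ :=
            Finset.sum_le_sum fun i _ => hglip p hp q hq _
        _ = n * ‖q - p‖ := by simp) ht (hT ω hω) (p := (w, θ, θ')) ((hmem _).2 ⟨hw, hθ, hθ'⟩)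
  have hp : (w, θ, θ') ∈ closedBall (0 : V) 1 := (hmem _).2 ⟨hw, hθ, hθ'⟩
  have hrank : (finrank ℝ V : ℝ) = 3 * d := by
    simp only [V, finrank_prod, finrank_euclideanSpace_fin]; push_cast; ring
  have hφi : Measurable fun x => inner ℝ (φ x) (θ - θ') := hφm.inner measurable_const
  have hsle : s (w, θ, θ') ≤ 36 * ∫ x, inner ℝ (φ x) (θ - θ') ^ 2 ∂ν := by
    rw [← integral_const_mul]
    refine integral_mono (hint2 _ hp) (Integrable.const_mul (.of_bound
      (hφi.pow_const 2).aestronglyMeasurable (‖θ - θ'‖ ^ 2) (ae_of_all _ fun x => ?_)) _)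
      fun x => ?_
    · rw [norm_pow]
      exact pow_le_pow_left₀ (norm_nonneg _) (abs_inner_feature_le hφ x _) 2
    · have h1 := abs_excessLoss_le hφ hY hw hθ hθ' x
      calc D (w, θ, θ') x ^ 2 = |D (w, θ, θ') x| ^ 2 := (sq_abs _).symm
        _ ≤ (6 * |inner ℝ (φ x) (θ - θ')|) ^ 2 := pow_le_pow_left₀ (abs_nonneg _) h1 2
        _ = 36 * inner ℝ (φ x) (θ - θ') ^ 2 := by rw [mul_pow, sq_abs]; norm_num
  have hsum : ∑ i, g (w, θ, θ') (ξ i ω) = n * (1 / 72 * m (w, θ, θ') -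
      (1 / 72) ^ 2 * s (w, θ, θ')) - 1 / 72 * ∑ i, D (w, θ, θ') (ξ i ω) := by
    simp only [g, Finset.sum_sub_distrib, Finset.sum_const, Finset.card_univ, Fintype.card_fin,
      nsmul_eq_mul, ← Finset.mul_sum]
    ring
  rw [hsum, hrank] at hfin
  have hn0 : (0 : ℝ) ≤ n := n.cast_nonneg
  have := mul_le_mul_of_nonneg_left hsle hn0
  change n * (m (w, θ, θ') - _) ≤ ∑ i, D (w, θ, θ') (ξ i ω) + _
  generalize m (w, θ, θ') = a, s (w, θ, θ') = b, ∑ i, D (w, θ, θ') (ξ i ω) = c at *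
  linarith

end ExcessLoss

end Concentration

/-! ### Bounded integrands and maxima over finitely many actions -/

theorem integrable_of_forall_abs_le {X : Type*} [MeasurableSpace X] {μ : Measure X}
    [IsFiniteMeasure μ] {f : X → ℝ} (hf : Measurable f) {c : ℝ} (hc : ∀ x, |f x| ≤ c) :
    Integrable f μ :=
  .of_bound hf.aestronglyMeasurable c (ae_of_all _ hc)

theorem abs_integral_le_of_ae {X : Type*} [MeasurableSpace X] {μ : Measure X}
    [IsProbabilityMeasure μ] {f : X → ℝ} {c : ℝ} (hc : ∀ᵐ x ∂μ, |f x| ≤ c) :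
    |∫ x, f x ∂μ| ≤ c := by
  simpa using norm_integral_le_of_norm_le_const (μ := μ) (f := f) hc

section FiniteActions

variable {S A : Type*} [MeasurableSpace S] [MeasurableSpace A] [Fintype A] [Nonempty A]
  [MeasurableSingletonClass A]

theorem measurable_uncurry_of_forall {β : Type*} [MeasurableSpace β] {f : S → A → β}
    (hf : ∀ a, Measurable fun s => f s a) : Measurable fun x : S × A => f x.1 x.2 :=
  measurable_from_prod_countable_left fun a => hf a

theorem le_maxQ (Q : QFun S A) (h : ℕ) (s : S) (a : A) : Q h s a ≤ maxQ Q h s :=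
  le_ciSup (f := fun a => Q h s a) (Set.finite_range _).bddAbove a

theorem measurable_maxQ {Q : QFun S A} {h : ℕ} (hQ : ∀ a, Measurable fun s => Q h s a) :
    Measurable (maxQ Q h) :=
  Measurable.iSup hQ

theorem abs_maxQ_le {Q : QFun S A} {h : ℕ} {s : S} {c : ℝ} (hQ : ∀ a, |Q h s a| ≤ c) :
    |maxQ Q h s| ≤ c := by
  obtain ⟨a⟩ := ‹Nonempty A›
  refine abs_le.2 ⟨(abs_le.1 (hQ a)).1.trans (le_maxQ Q h s a), ?_⟩
  have : Nonempty A := ⟨a⟩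
  exact ciSup_le fun a => (abs_le.1 (hQ a)).2

theorem abs_maxQ_sub_maxQ_le {Q Q' : QFun S A} {h : ℕ} {s : S} {c : ℝ}
    (hQ : ∀ a, |Q h s a - Q' h s a| ≤ c) : |maxQ Q h s - maxQ Q' h s| ≤ c := by
  have h1 : maxQ Q h s ≤ maxQ Q' h s + c := ciSup_le fun a => by
    linarith [(abs_le.1 (hQ a)).2, le_maxQ Q' h s a]
  have h2 : maxQ Q' h s ≤ maxQ Q h s + c := ciSup_le fun a => by
    linarith [(abs_le.1 (hQ a)).1, le_maxQ Q h s a]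
  exact abs_le.2 ⟨by linarith, by linarith⟩

theorem maxQ_eq_of_isMax {Q : QFun S A} {h : ℕ} {s : S} {a₀ : A} (hQ : ∀ a, Q h s a ≤ Q h s a₀) :
    maxQ Q h s = Q h s a₀ :=
  le_antisymm (ciSup_le hQ) (le_maxQ Q h s a₀)

/-- Measurable state-action functions have (measurable) greedy policies. -/
theorem exists_greedy_policy {Q : QFun S A} (hQ : ∀ h a, Measurable fun s => Q h s a) :
    ∃ π : Policy S A, ∀ h s a, Q h s a ≤ Q h s (π.act h s) := by
  classical
  let e : A ≃ Fin (Fintype.card A) := Fintype.equivFin A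
  -- Ties are broken by the least index in an enumeration of the actions, which makes the selection
  -- measurable.
  have hex : ∀ h s, ∃ k : ℕ, ∃ hk : k < Fintype.card A, ∀ a, Q h s a ≤ Q h s (e.symm ⟨k, hk⟩) := by
    intro h s
    obtain ⟨a, ha⟩ := Finite.exists_max (Q h s)
    exact ⟨e a, (e a).2, fun a' => by simpa using ha a'⟩
  have hmeas : ∀ h, Measurable fun s => Nat.find (hex h s) := by
    intro h
    refine measurable_find (hex h) fun k => ?_
    by_cases hk : k < Fintype.card A
    · have : {s | ∃ hk : k < Fintype.card A, ∀ a, Q h s a ≤ Q h s (e.symm ⟨k, hk⟩)} =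
          ⋂ a, {s | Q h s a ≤ Q h s (e.symm ⟨k, hk⟩)} := by
        ext s; simp [hk]
      rw [this]
      exact MeasurableSet.iInter fun a => measurableSet_le (hQ h a) (hQ h _)
    · have : {s | ∃ hk : k < Fintype.card A, ∀ a, Q h s a ≤ Q h s (e.symm ⟨k, hk⟩)} = ∅ := by
        ext s; simp [hk]
      rw [this]
      exact MeasurableSet.empty
  let pick : ℕ → A := fun k => if hk : k < Fintype.card A then e.symm ⟨k, hk⟩ else
    Classical.arbitrary A
  refine ⟨⟨fun h s => pick (Nat.find (hex h s)),
    fun h => (measurable_of_countable pick).comp (hmeas h)⟩, fun h s a => ?_⟩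
  obtain ⟨hk, hmax⟩ := Nat.find_spec (hex h s)
  have : pick (Nat.find (hex h s)) = e.symm ⟨_, hk⟩ := dif_pos hk
  show Q h s a ≤ Q h s (pick (Nat.find (hex h s)))
  rw [this]
  exact hmax a

end FiniteActions

/-! ### Trajectory laws and their one-step disintegration -/

namespace MDP

section Kernels

variable {S A : Type*} [MeasurableSpace S] [MeasurableSpace A] (M : MDP S A)

theorem measurable_cons_step {n : ℕ} :
    Measurable fun q : Step S A × (Fin n → Step S A) =>
      (Fin.cons q.1 q.2 : Fin (n + 1) → Step S A) := by
  refine measurable_pi_iff.2 fun i => ?_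
  refine Fin.cases ?_ (fun j => ?_) i
  · simpa using measurable_fst
  · simp only [Fin.cons_succ]
    exact (measurable_pi_apply j).comp measurable_snd

instance isMarkovKernel_stepKernel (π : Policy S A) (h : ℕ) :
    IsMarkovKernel (M.stepKernel π h) := by
  unfold stepKernel; infer_instance

instance isMarkovKernel_pathKernel (π : Policy S A) (n h : ℕ) :
    IsMarkovKernel (M.pathKernel π n h) := by
  induction n generalizing h with
  | zero => unfold pathKernel; infer_instance
  | succ n ih =>
    have := ih (h + 1)
    unfold pathKernel
    exact Kernel.IsMarkovKernel.map _ measurable_cons_step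

theorem lintegral_pathKernel_succ (π : Policy S A) (n h : ℕ) (s : S)
    {f : (Fin (n + 1) → Step S A) → ℝ≥0∞} (hf : Measurable f) :
    ∫⁻ τ, f τ ∂M.pathKernel π (n + 1) h s =
      ∫⁻ q, ∫⁻ τ, f (Fin.cons ((s, π.act h s), q) τ) ∂M.pathKernel π n (h + 1) q.2
        ∂M.step h (s, π.act h s) := by
  have hf' : Measurable fun q : Step S A × (Fin n → Step S A) => f (Fin.cons q.1 q.2) :=
    hf.comp measurable_cons_step
  have hinner : Measurable fun x : Step S A =>
      ∫⁻ τ, f (Fin.cons x τ) ∂M.pathKernel π n (h + 1) x.2.2 :=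
    Measurable.lintegral_kernel_prod_right' (κ := (M.pathKernel π n (h + 1)).comap
      (fun x : Step S A => x.2.2) (by fun_prop)) hf'
  rw [pathKernel, Kernel.map_apply _ measurable_cons_step, lintegral_map hf measurable_cons_step,
    Kernel.lintegral_compProd _ _ _ hf']
  simp only [Kernel.comap_apply]
  rw [stepKernel, Kernel.lintegral_compProd _ _ _ hinner]
  simp only [Kernel.prodMkLeft_apply]
  rw [Kernel.lintegral_deterministic' _
    (Measurable.lintegral_kernel_prod_right' (κ := M.step h) hinner)]

theorem integral_pathKernel_succ (π : Policy S A) (n h : ℕ) (s : S)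
    {f : (Fin (n + 1) → Step S A) → ℝ} (hf : Measurable f) {c : ℝ} (hc : ∀ τ, |f τ| ≤ c) :
    ∫ τ, f τ ∂M.pathKernel π (n + 1) h s =
      ∫ q, ∫ τ, f (Fin.cons ((s, π.act h s), q) τ) ∂M.pathKernel π n (h + 1) q.2
        ∂M.step h (s, π.act h s) := by
  have hf' : Measurable fun q : Step S A × (Fin n → Step S A) => f (Fin.cons q.1 q.2) :=
    hf.comp measurable_cons_step
  have hinner : Measurable fun x : Step S A =>
      ∫ τ, f (Fin.cons x τ) ∂M.pathKernel π n (h + 1) x.2.2 :=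
    (StronglyMeasurable.integral_kernel_prod_right' (κ := (M.pathKernel π n (h + 1)).comap
      (fun x : Step S A => x.2.2) (by fun_prop)) hf'.stronglyMeasurable).measurable
  have hinc : ∀ x : Step S A, |∫ τ, f (Fin.cons x τ) ∂M.pathKernel π n (h + 1) x.2.2| ≤ c :=
    fun x => abs_integral_le_of_ae (ae_of_all _ fun _ => hc _)
  rw [pathKernel, Kernel.map_apply _ measurable_cons_step,
    integral_map measurable_cons_step.aemeasurable hf.aestronglyMeasurable,
    integral_compProd (integrable_of_forall_abs_le hf' fun q => hc _)]
  simp only [Kernel.comap_apply]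
  rw [stepKernel, integral_compProd (integrable_of_forall_abs_le hinner hinc)]
  simp only [Kernel.prodMkLeft_apply]
  rw [Kernel.integral_deterministic' _
    (StronglyMeasurable.integral_kernel_prod_right' (κ := M.step h) hinner.stronglyMeasurable)]

/-- Given the state-action pair at some stage, the reward and the next state have the law
prescribed by the MDP. -/
theorem lintegral_pathKernel_step (π : Policy S A) (n h : ℕ) (s : S) (j : Fin n)
    {f : Step S A → ℝ≥0∞} (hf : Measurable f) :
    ∫⁻ τ, f (τ j) ∂M.pathKernel π n h s =
      ∫⁻ τ, ∫⁻ q, f ((τ j).1, q) ∂M.step (h + j) (τ j).1 ∂M.pathKernel π n h s := by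
  induction n generalizing h s with
  | zero => exact j.elim0
  | succ n ih =>
    have hm : ∀ k, Measurable fun x : S × A => ∫⁻ q, f (x, q) ∂M.step k x := fun k =>
      Measurable.lintegral_kernel_prod_right' hf
    have hj : Measurable fun τ : Fin (n + 1) → Step S A => τ j := measurable_pi_apply j
    rw [lintegral_pathKernel_succ M π n h s (f := fun τ => f (τ j)) (hf.comp hj),
      lintegral_pathKernel_succ M π n h s
        (f := fun τ => ∫⁻ q, f ((τ j).1, q) ∂M.step (h + j) (τ j).1)
        ((hm (h + j)).comp (measurable_fst.comp hj))]
    refine Fin.cases ?_ (fun i => ?_) j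
    · simp
    · simp only [Fin.cons_succ]
      refine lintegral_congr fun q => ?_
      rw [ih (h + 1) q.2 i]
      have : h + 1 + (i : ℕ) = h + (i.succ : Fin (n + 1)) := by
        rw [Fin.val_succ]; omega
      rw [this]

instance isProbabilityMeasure_law (π : Policy S A) : IsProbabilityMeasure (M.law π) := by
  unfold law; infer_instance

theorem lintegral_law (π : Policy S A) {f : M.Traj → ℝ≥0∞} (hf : Measurable f) :
    ∫⁻ τ, f τ ∂M.law π = ∫⁻ s, ∫⁻ τ, f τ ∂M.pathKernel π M.H 0 s ∂M.ρ :=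
  Measure.lintegral_bind (Kernel.aemeasurable _) hf.aemeasurable

theorem integral_law (π : Policy S A) {f : M.Traj → ℝ} (hf : Measurable f) {c : ℝ}
    (hc : ∀ τ, |f τ| ≤ c) :
    ∫ τ, f τ ∂M.law π = ∫ s, ∫ τ, f τ ∂M.pathKernel π M.H 0 s ∂M.ρ := by
  have e : M.law π = (M.pathKernel π M.H 0 ∘ₖ Kernel.const Unit M.ρ) () := by
    rw [Kernel.comp_apply, Kernel.const_apply]; rfl
  have hi : Integrable f (M.law π) := integrable_of_forall_abs_le hf hc
  rw [e] at hi ⊢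
  rw [Kernel.integral_comp hi, Kernel.const_apply]

instance isProbabilityMeasure_controllerLaw (π : Controller S A) :
    IsProbabilityMeasure (M.controllerLaw π) := by
  refine ⟨?_⟩
  have h := π.weight.tsum_coe
  rw [tsum_fintype] at h
  simpa [controllerLaw] using h

/-- Every policy in the mixture leaves the conditional law of reward and next state given the pair
(s, a) equal to the MDP kernel, so the mixture does too. This is what makes the regression labels
conditionally unbiased for the Bellman backup. -/
theorem map_law_step (π : Controller S A) (h : Fin M.H) :
    (M.controllerLaw π).map (fun τ => τ h) =
      ((M.controllerLaw π).map fun τ => (τ h).1) ⊗ₘ M.step h := by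
  have hev : Measurable fun τ : M.Traj => τ h := measurable_pi_apply h
  have hlaw : ∀ (π' : Policy S A) {f : Step S A → ℝ≥0∞}, Measurable f →
      ∫⁻ τ, f (τ h) ∂M.law π' = ∫⁻ τ, ∫⁻ q, f ((τ h).1, q) ∂M.step h (τ h).1 ∂M.law π' := by
    intro π' f hf
    have hm : Measurable fun x : S × A => ∫⁻ q, f (x, q) ∂M.step h x :=
      Measurable.lintegral_kernel_prod_right' hf
    rw [lintegral_law M π' (f := fun τ => f (τ h)) (hf.comp hev),
      lintegral_law M π' (f := fun τ => ∫⁻ q, f ((τ h).1, q) ∂M.step h (τ h).1)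
        (hm.comp (measurable_fst.comp hev))]
    refine lintegral_congr fun s => ?_
    have := lintegral_pathKernel_step M π' M.H 0 s h hf
    simpa only [Nat.zero_add] using this
  refine Measure.ext_of_lintegral _ fun f hf => ?_
  have hm : Measurable fun x : S × A => ∫⁻ q, f (x, q) ∂M.step h x :=
    Measurable.lintegral_kernel_prod_right' hf
  have : IsProbabilityMeasure ((M.controllerLaw π).map fun τ => (τ h).1) :=
    Measure.isProbabilityMeasure_map (measurable_fst.comp hev).aemeasurable
  rw [lintegral_map hf hev, Measure.lintegral_compProd hf, lintegral_map hm
    (hev.fst)]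
  simp only [controllerLaw, lintegral_finsetSum_measure, lintegral_smul_measure]
  exact Finset.sum_congr rfl fun i _ => by rw [hlaw _ hf]

end Kernels

end MDP

/-! ### Value functions, dynamic programming and the performance-difference identity -/

namespace MDP

section Values

variable {S A : Type*} [MeasurableSpace S] [MeasurableSpace A] [Fintype A] [Nonempty A]
  [MeasurableSingletonClass A] (M : MDP S A)

/-- Expected sum of the values of `g` along the `n` steps made by `π` from stage `h` on. -/
def pathSum (g : QFun S A) (π : Policy S A) (n h : ℕ) (s : S) : ℝ :=
  ∫ τ, ∑ j : Fin n, g (h + j) (τ j).1.1 (τ j).1.2 ∂M.pathKernel π n h s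

/-- Measurability and boundedness of a family of state-action functions on the stages `< H`. -/
structure IsBoundedBefore (g : QFun S A) (c : ℝ) : Prop where
  measurable : ∀ h < M.H, ∀ a, Measurable fun s => g h s a
  abs_le : ∀ h < M.H, ∀ s a, |g h s a| ≤ c

variable {M}

theorem IsBoundedBefore.measurable_sum {g : QFun S A} {c : ℝ} (hg : M.IsBoundedBefore g c)
    {n h : ℕ} (hn : h + n ≤ M.H) :
    Measurable fun τ : Fin n → Step S A => ∑ j : Fin n, g (h + j) (τ j).1.1 (τ j).1.2 :=
  Finset.measurable_sum _ fun j _ =>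
    (measurable_uncurry_of_forall (hg.measurable (h + j) (by omega))).comp
      (measurable_pi_apply j).fst

theorem IsBoundedBefore.abs_sum_le {g : QFun S A} {c : ℝ} (hg : M.IsBoundedBefore g c)
    {n h : ℕ} (hn : h + n ≤ M.H) (τ : Fin n → Step S A) :
    |∑ j : Fin n, g (h + j) (τ j).1.1 (τ j).1.2| ≤ n * c := by
  calc _ ≤ ∑ j : Fin n, |g (h + j) (τ j).1.1 (τ j).1.2| := Finset.abs_sum_le_sum_abs _ _
    _ ≤ ∑ _j : Fin n, c := Finset.sum_le_sum fun j _ => hg.abs_le _ (by omega) _ _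
    _ = n * c := by simp

theorem IsBoundedBefore.abs_pathSum_le {g : QFun S A} {c : ℝ} (hg : M.IsBoundedBefore g c)
    {n h : ℕ} (hn : h + n ≤ M.H) (π : Policy S A) (s : S) : |M.pathSum g π n h s| ≤ n * c :=
  abs_integral_le_of_ae (ae_of_all _ (hg.abs_sum_le hn))

theorem IsBoundedBefore.measurable_pathSum {g : QFun S A} {c : ℝ} (hg : M.IsBoundedBefore g c)
    {n h : ℕ} (hn : h + n ≤ M.H) (π : Policy S A) : Measurable (M.pathSum g π n h) :=
  (StronglyMeasurable.integral_kernel_prod_right' (κ := M.pathKernel π n h)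
    (f := fun x : S × (Fin n → Step S A) =>
      ∑ j : Fin n, g (h + j) (x.2 j).1.1 (x.2 j).1.2)
    ((hg.measurable_sum hn).comp measurable_snd).stronglyMeasurable).measurable

theorem IsBoundedBefore.integrable_pathSum {g : QFun S A} {c : ℝ} (hg : M.IsBoundedBefore g c)
    {n h : ℕ} (hn : h + n ≤ M.H) (π : Policy S A) (k : ℕ) (x : S × A) :
    Integrable (fun q => M.pathSum g π n h q.2) (M.step k x) :=
  integrable_of_forall_abs_le ((hg.measurable_pathSum hn π).comp measurable_snd)
    fun q => hg.abs_pathSum_le hn π q.2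

variable (M) in
theorem integrable_maxQ {Q : QFun S A} {c : ℝ} {h : ℕ} (hQm : ∀ a, Measurable fun s => Q h s a)
    (hQc : ∀ s a, |Q h s a| ≤ c) (k : ℕ) (x : S × A) :
    Integrable (fun q => maxQ Q h q.2) (M.step k x) :=
  integrable_of_forall_abs_le ((measurable_maxQ hQm).comp measurable_snd)
    fun q => abs_maxQ_le fun a => hQc q.2 a

/-- The Bellman equation of a fixed policy for an arbitrary running reward `g`. It is applied both
to mean rewards and to Bellman errors. -/
theorem IsBoundedBefore.pathSum_succ {g : QFun S A} {c : ℝ} (hg : M.IsBoundedBefore g c)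
    {n h : ℕ} (hn : h + (n + 1) ≤ M.H) (π : Policy S A) (s : S) :
    M.pathSum g π (n + 1) h s = g h s (π.act h s) +
      ∫ q, M.pathSum g π n (h + 1) q.2 ∂M.step h (s, π.act h s) := by
  have hn' : h + 1 + n ≤ M.H := by omega
  have hidx : ∀ i : Fin n, h + ((i.succ : Fin (n + 1)) : ℕ) = h + 1 + i := fun i => by
    rw [Fin.val_succ]; omega
  unfold pathSum
  rw [integral_pathKernel_succ M π n h s (hg.measurable_sum hn) (hg.abs_sum_le hn)]
  have hinner : ∀ q : ℝ × S,
      ∫ τ, (∑ j : Fin (n + 1), g (h + j)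
        ((Fin.cons ((s, π.act h s), q) τ : Fin (n + 1) → Step S A) j).1.1
        ((Fin.cons ((s, π.act h s), q) τ : Fin (n + 1) → Step S A) j).1.2)
          ∂M.pathKernel π n (h + 1) q.2 =
      g h s (π.act h s) + M.pathSum g π n (h + 1) q.2 := by
    intro q
    have e : ∀ τ : Fin n → Step S A, (∑ j : Fin (n + 1), g (h + j)
        ((Fin.cons ((s, π.act h s), q) τ : Fin (n + 1) → Step S A) j).1.1
        ((Fin.cons ((s, π.act h s), q) τ : Fin (n + 1) → Step S A) j).1.2) =
        g h s (π.act h s) + ∑ i : Fin n, g (h + 1 + i) (τ i).1.1 (τ i).1.2 := by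
      intro τ
      rw [Fin.sum_univ_succ]
      simp only [Fin.cons_zero, Fin.cons_succ, hidx, Fin.val_zero, Nat.add_zero]
    simp_rw [e]
    rw [integral_add (integrable_const _)
      (integrable_of_forall_abs_le (hg.measurable_sum hn') (hg.abs_sum_le hn'))]
    simp [pathSum]
  simp_rw [hinner]
  rw [integral_add (integrable_const _) (hg.integrable_pathSum hn' π _ _)]
  simp [pathSum]

variable (M) in
theorem value_eq_pathSum (π : Policy S A) (h : ℕ) (s : S) :
    M.value π h s = M.pathSum M.meanReward π (M.H - h) h s := rfl

theorem BoundedRewards.isBoundedBefore (hM : M.BoundedRewards) :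
    M.IsBoundedBefore M.meanReward 1 where
  measurable h _ a := by
    have : Measurable fun x : S × A => ∫ q, q.1 ∂M.step h x :=
      (StronglyMeasurable.integral_kernel_prod_right' (κ := M.step h)
        (f := fun x : (S × A) × (ℝ × S) => x.2.1)
        (by fun_prop : Measurable fun x : (S × A) × (ℝ × S) => x.2.1).stronglyMeasurable).measurable
    exact this.comp (measurable_id.prodMk measurable_const)
  abs_le h hh s a := abs_integral_le_of_ae (hM h hh s a)

theorem BoundedRewards.isBoundedBefore_bellman (hM : M.BoundedRewards) {Q : QFun S A} {c : ℝ}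
    (hQm : ∀ h a, Measurable fun s => Q h s a) (hQc : ∀ h s a, |Q h s a| ≤ c) :
    M.IsBoundedBefore (M.bellman Q) (1 + c) where
  measurable h hh a := by
    have hm : Measurable fun x : (S × A) × (ℝ × S) => maxQ Q (h + 1) x.2.2 :=
      (measurable_maxQ (hQm (h + 1))).comp (by fun_prop)
    have : Measurable fun x : S × A => ∫ q, maxQ Q (h + 1) q.2 ∂M.step h x :=
      (StronglyMeasurable.integral_kernel_prod_right' (κ := M.step h) hm.stronglyMeasurable).measurable
    exact (hM.isBoundedBefore.measurable h hh a).add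
      (this.comp (measurable_id.prodMk measurable_const))
  abs_le h hh s a := (abs_add_le _ _).trans (add_le_add (hM.isBoundedBefore.abs_le h hh s a)
    (abs_integral_le_of_ae (ae_of_all _ fun q => abs_maxQ_le fun a => hQc (h + 1) q.2 a)))

/-- The performance-difference identity: for a greedy policy, the gap between the predicted and the
true values is the expected sum of the Bellman errors. -/
theorem BoundedRewards.maxQ_sub_pathSum_eq (hM : M.BoundedRewards) {Q : QFun S A} {c : ℝ}
    (hQm : ∀ h a, Measurable fun s => Q h s a) (hQc : ∀ h s a, |Q h s a| ≤ c)
    (hQH : Q M.H = 0) {π : Policy S A} (hπ : IsGreedy M.H Q π) {n h : ℕ} (hn : h + n = M.H)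
    (s : S) :
    maxQ Q h s - M.pathSum M.meanReward π n h s = M.pathSum (bellmanError M Q) π n h s := by
  have hr := hM.isBoundedBefore
  have hT := hM.isBoundedBefore_bellman hQm hQc
  have hE : M.IsBoundedBefore (bellmanError M Q) (c + (1 + c)) :=
    ⟨fun h hh a => (hQm h a).sub (hT.measurable h hh a), fun h hh s a =>
      (abs_sub _ _).trans (add_le_add (hQc h s a) (hT.abs_le h hh s a))⟩
  induction n generalizing h s with
  | zero =>
    obtain rfl : h = M.H := by omega
    simp [pathSum, maxQ, hQH]
  | succ n ih =>
    rw [hr.pathSum_succ hn.le, hE.pathSum_succ hn.le]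
    have hh : h < M.H := by omega
    have hn' : h + 1 + n = M.H := by omega
    simp_rw [← ih hn']
    rw [integral_sub (integrable_maxQ M (hQm (h + 1)) (hQc (h + 1)) _ _)
      (hr.integrable_pathSum hn'.le π _ _),
      maxQ_eq_of_isMax (hπ h hh s)]
    simp only [bellmanError, bellman]
    ring

/-- The optimal value of a state with `n` stages to go. -/
def optToGo (M : MDP S A) : ℕ → S → ℝ
  | 0, _ => 0
  | n + 1, s => ⨆ a, (M.meanReward (M.H - (n + 1)) s a +
      ∫ q, optToGo M n q.2 ∂M.step (M.H - (n + 1)) (s, a))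

/-- The optimal action-value function. -/
def optQ (M : MDP S A) : QFun S A := fun h s a =>
  if h < M.H then M.meanReward h s a + ∫ q, optToGo M (M.H - h - 1) q.2 ∂M.step h (s, a) else 0

theorem maxQ_optQ (h : ℕ) (s : S) : maxQ (optQ M) h s = optToGo M (M.H - h) s := by
  by_cases hh : h < M.H
  · obtain ⟨n, hn⟩ : ∃ n, M.H - h = n + 1 := ⟨M.H - h - 1, by omega⟩
    have h1 : M.H - (n + 1) = h := by omega
    have h2 : M.H - h - 1 = n := by omega
    simp only [maxQ, optQ, if_pos hh, hn, optToGo, h1]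
    simp
  · have : M.H - h = 0 := by omega
    simp [maxQ, optQ, if_neg hh, this, optToGo]

theorem bellman_optQ {h : ℕ} (hh : h < M.H) (s : S) (a : A) :
    M.bellman (optQ M) h s a = optQ M h s a := by
  simp only [bellman, maxQ_optQ]
  rw [optQ, if_pos hh, Nat.sub_sub]

/-- Backward induction on the stages to go. Measurability of the optimal value, a supremum over
possibly uncountably many policies, is obtained through this function and a finite maximum. -/
theorem BoundedRewards.optQ_bounded (hM : M.BoundedRewards) :
    (∀ h a, Measurable fun s => optQ M h s a) ∧ ∀ h s a, |optQ M h s a| ≤ M.H := by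
  have hr := hM.isBoundedBefore
  have key : ∀ n, n ≤ M.H → ∀ h, M.H - h = n → (∀ a, Measurable fun s => optQ M h s a) ∧
      ∀ s a, |optQ M h s a| ≤ n := by
    intro n
    induction n with
    | zero =>
      intro _ h hh
      have : ¬ h < M.H := by omega
      simp [optQ, if_neg this]
    | succ n ih =>
      intro hn h hh
      have hlt : h < M.H := by omega
      obtain ⟨i1, i2⟩ := ih (by omega) (h + 1) (by omega)
      have e : ∀ s a, optQ M h s a =
          M.meanReward h s a + ∫ q, maxQ (optQ M) (h + 1) q.2 ∂M.step h (s, a) := fun s a => by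
        rw [← bellman_optQ hlt, bellman]
      refine ⟨fun a => ?_, fun s a => ?_⟩
      · simp_rw [e]
        have hm : Measurable fun x : (S × A) × (ℝ × S) => maxQ (optQ M) (h + 1) x.2.2 :=
          (measurable_maxQ i1).comp (by fun_prop)
        have : Measurable fun x : S × A => ∫ q, maxQ (optQ M) (h + 1) q.2 ∂M.step h x :=
          (StronglyMeasurable.integral_kernel_prod_right' (κ := M.step h)
            hm.stronglyMeasurable).measurable
        exact (hr.measurable h hlt a).add (this.comp (measurable_id.prodMk measurable_const))
      · rw [e]
        have h1 : |∫ q, maxQ (optQ M) (h + 1) q.2 ∂M.step h (s, a)| ≤ n :=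
          abs_integral_le_of_ae (ae_of_all _ fun q => abs_maxQ_le fun a => i2 q.2 a)
        have h2 := hr.abs_le h hlt s a
        push_cast
        exact (abs_add_le _ _).trans (by linarith)
  refine ⟨fun h => (key (M.H - h) (by omega) h rfl).1, fun h s a => ?_⟩
  refine ((key (M.H - h) (by omega) h rfl).2 s a).trans ?_
  exact_mod_cast Nat.sub_le _ _

/-- The optimal value is the maximum of the optimal action-value function. -/
theorem BoundedRewards.optValue_eq (hM : M.BoundedRewards) (s : S) :
    M.optValue 0 s = maxQ (optQ M) 0 s := by
  have hr := hM.isBoundedBefore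
  obtain ⟨hm, hc⟩ := hM.optQ_bounded
  have hH : optQ M M.H = 0 := by funext s a; simp [optQ]
  have hle : ∀ (π : Policy S A) (n h : ℕ), h + n = M.H → ∀ s,
      M.pathSum M.meanReward π n h s ≤ maxQ (optQ M) h s := by
    intro π n
    induction n with
    | zero =>
      intro h hn s
      obtain rfl : h = M.H := by omega
      simp [pathSum, maxQ, hH]
    | succ n ih =>
      intro h hn s
      have hn' : h + 1 + n = M.H := by omega
      rw [hr.pathSum_succ hn.le]
      refine le_trans ?_ (le_maxQ _ h s (π.act h s))
      rw [← bellman_optQ (by omega), bellman]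
      gcongr
      · exact hr.integrable_pathSum hn'.le π _ _
      · exact integrable_maxQ M (hm (h + 1)) (hc (h + 1)) _ _
      · exact fun q => ih (h + 1) hn' q.2
  obtain ⟨π₀, hπ₀⟩ := exists_greedy_policy hm
  -- A greedy policy for the optimal action values has zero Bellman errors, so the
  -- performance-difference identity shows that it attains the bound.
  have heq : M.value π₀ 0 s = maxQ (optQ M) 0 s := by
    have h1 := hM.maxQ_sub_pathSum_eq hm hc hH (π := π₀) (fun h _ => hπ₀ h) (n := M.H) (h := 0)
      (by omega) s
    have h2 : M.pathSum (bellmanError M (optQ M)) π₀ M.H 0 s = 0 := by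
      unfold pathSum
      have : ∀ τ : Fin M.H → Step S A, ∑ j : Fin M.H,
          bellmanError M (optQ M) (0 + j) (τ j).1.1 (τ j).1.2 = 0 := fun τ =>
        Finset.sum_eq_zero fun j _ => by
          rw [bellmanError, bellman_optQ (by omega), sub_self]
      simp_rw [this, integral_zero]
    rw [value_eq_pathSum, Nat.sub_zero]
    linarith
  have hle' : ∀ π : Policy S A, M.value π 0 s ≤ maxQ (optQ M) 0 s := fun π =>
    hle π (M.H - 0) 0 (by omega) s
  have : Nonempty (Policy S A) := ⟨π₀⟩
  refine le_antisymm (ciSup_le hle') ?_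
  rw [← heq]
  exact le_ciSup ⟨_, Set.forall_mem_range.2 hle'⟩ π₀

/-- Integrated performance-difference identity. -/
theorem BoundedRewards.integral_maxQ_sub_value (hM : M.BoundedRewards) {Q : QFun S A}
    (hQ : Q ∈ M.QAll) {π : Policy S A} (hπ : IsGreedy M.H Q π) :
    ∫ s, (maxQ Q 0 s - M.value π 0 s) ∂M.ρ =
      ∫ τ, ∑ h : Fin M.H, bellmanError M Q h (τ h).1.1 (τ h).1.2 ∂M.law π := by
  obtain ⟨hQm, hQc, hQH⟩ := hQ
  have hT := hM.isBoundedBefore_bellman hQm hQc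
  have hE : M.IsBoundedBefore (bellmanError M Q) (1 + (1 + 1)) :=
    ⟨fun h hh a => (hQm h a).sub (hT.measurable h hh a), fun h hh s a =>
      (abs_sub _ _).trans (add_le_add (hQc h s a) (hT.abs_le h hh s a))⟩
  have hm := hE.measurable_sum (n := M.H) (h := 0) (by omega)
  have hb := hE.abs_sum_le (n := M.H) (h := 0) (by omega)
  simp only [Nat.zero_add] at hm hb
  rw [integral_law M π hm hb]
  refine integral_congr_ae (ae_of_all _ fun s => ?_)
  have := hM.maxQ_sub_pathSum_eq hQm hQc hQH hπ (n := M.H) (h := 0) (by omega) s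
  simpa only [value_eq_pathSum, Nat.sub_zero, pathSum, Nat.zero_add] using this

/-- Pointwise this is V^π ≤ V^*. The substance is integrability of both sides, which for V^* rests
on its dynamic-programming form. -/
theorem BoundedRewards.integral_sub_optValue_le (hM : M.BoundedRewards) {Q : QFun S A}
    (hQ : Q ∈ M.QAll) (π : Policy S A) :
    ∫ s, (maxQ Q 0 s - M.optValue 0 s) ∂M.ρ ≤ ∫ s, (maxQ Q 0 s - M.value π 0 s) ∂M.ρ := by
  have hr := hM.isBoundedBefore
  obtain ⟨hm, hc⟩ := hM.optQ_bounded
  have hb : ∀ s, |M.optValue 0 s| ≤ M.H := fun s => by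
    rw [hM.optValue_eq]; exact abs_maxQ_le fun a => hc 0 s a
  have hmo : Measurable (M.optValue 0) := by
    have : M.optValue 0 = maxQ (optQ M) 0 := funext hM.optValue_eq
    rw [this]; exact measurable_maxQ (hm 0)
  have hv : Measurable (M.value π 0) := hr.measurable_pathSum (by omega) π
  have hvb : ∀ π s, |M.value π 0 s| ≤ (M.H - 0 : ℕ) * 1 := fun π s =>
    hr.abs_pathSum_le (by omega) π s
  have hQi : Integrable (maxQ Q 0) M.ρ :=
    integrable_of_forall_abs_le (measurable_maxQ (hQ.1 0)) fun s => abs_maxQ_le fun a =>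
      hQ.2.1 0 s a
  refine integral_mono (hQi.sub (integrable_of_forall_abs_le hmo hb))
    (hQi.sub (integrable_of_forall_abs_le hv (hvb π))) fun s => ?_
  have : M.value π 0 s ≤ M.optValue 0 s :=
    le_ciSup (f := fun π => M.value π 0 s)
      ⟨_, Set.forall_mem_range.2 fun π => (abs_le.1 (hvb π s)).2⟩ π
  show maxQ Q 0 s - M.optValue 0 s ≤ maxQ Q 0 s - M.value π 0 s
  linarith

end Values

end MDP

/-! ### Recursive least squares as constrained ridge regression -/

section Ridge

open Matrix

variable {d : ℕ}

theorem inner_eq_dotProduct (x y : EuclideanSpace ℝ (Fin d)) :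
    (inner ℝ x y : ℝ) = x.ofLp ⬝ᵥ y.ofLp := by
  rw [EuclideanSpace.inner_eq_star_dotProduct, dotProduct_comm]; simp

/-- The regularized empirical covariance of the first `n` feature vectors. -/
def empCov (lam : ℝ) (z : ℕ → EuclideanSpace ℝ (Fin d)) (n : ℕ) : Matrix (Fin d) (Fin d) ℝ :=
  lam • 1 + ∑ i ∈ Finset.range n, vecMulVec (z i).ofLp (z i).ofLp

/-- The empirical correlation of the first `n` feature vectors and labels. -/
def empMoment (z : ℕ → EuclideanSpace ℝ (Fin d)) (y : ℕ → ℝ) (n : ℕ) : Fin d → ℝ :=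
  ∑ i ∈ Finset.range n, y i • (z i).ofLp

/-- The regularized empirical squared loss. -/
def ridgeLoss (lam : ℝ) (z : ℕ → EuclideanSpace ℝ (Fin d)) (y : ℕ → ℝ) (n : ℕ)
    (w : EuclideanSpace ℝ (Fin d)) : ℝ :=
  lam * ‖w‖ ^ 2 + ∑ i ∈ Finset.range n, (inner ℝ (z i) w - y i) ^ 2

variable {lam : ℝ} {z : ℕ → EuclideanSpace ℝ (Fin d)} {y : ℕ → ℝ} {n : ℕ}

theorem empCov_succ : empCov lam z (n + 1) = empCov lam z n + vecMulVec (z n).ofLp (z n).ofLp := by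
  simp only [empCov, Finset.sum_range_succ, add_assoc]

theorem dotProduct_empCov_mulVec (v w : EuclideanSpace ℝ (Fin d)) :
    v.ofLp ⬝ᵥ (empCov lam z n *ᵥ w.ofLp) =
      lam * inner ℝ v w + ∑ i ∈ Finset.range n, inner ℝ (z i) v * inner ℝ (z i) w := by
  simp only [inner_eq_dotProduct]
  induction n with
  | zero => simp [empCov, smul_mulVec]
  | succ n ih =>
    rw [empCov_succ, add_mulVec, dotProduct_add, ih, Finset.sum_range_succ, vecMulVec_mulVec]
    simp only [op_smul_eq_smul, dotProduct_smul, smul_eq_mul]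
    rw [dotProduct_comm v.ofLp (z n).ofLp]
    ring

theorem quad_empCov (w : EuclideanSpace ℝ (Fin d)) :
    quad (empCov lam z n) w =
      lam * ‖w‖ ^ 2 + ∑ i ∈ Finset.range n, (inner ℝ (z i) w : ℝ) ^ 2 := by
  rw [quad, dotProduct_empCov_mulVec, real_inner_self_eq_norm_sq]
  simp only [sq]

theorem posDef_empCov (hlam : 0 < lam) : (empCov lam z n).PosDef := by
  refine PosDef.of_dotProduct_mulVec_pos ?_ fun v hv => ?_
  · rw [IsHermitian, empCov]
    simp [transpose_sum, transpose_vecMulVec]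
  · have h := dotProduct_empCov_mulVec (lam := lam) (z := z) (n := n) (WithLp.toLp 2 v)
      (WithLp.toLp 2 v)
    simp only at h
    rw [star_trivial, h, real_inner_self_eq_norm_sq]
    have h1 : 0 < ‖WithLp.toLp 2 v‖ := norm_pos_iff.2 fun h0 => hv (by simpa using h0)
    have h2 : 0 ≤ ∑ i ∈ Finset.range n,
        (inner ℝ (z i) (WithLp.toLp 2 v) * inner ℝ (z i) (WithLp.toLp 2 v) : ℝ) :=
      Finset.sum_nonneg fun i _ => mul_self_nonneg _
    positivity

theorem quad_nonneg_of_mul_empCov (hlam : 0 < lam) {P : Matrix (Fin d) (Fin d) ℝ}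
    (hP : P * empCov lam z n = 1) (x : EuclideanSpace ℝ (Fin d)) : 0 ≤ quad P x := by
  have h : P = (empCov lam z n)⁻¹ := (Matrix.inv_eq_left_inv hP).symm
  have := (posDef_empCov (z := z) (n := n) hlam).inv.posSemidef.dotProduct_mulVec_nonneg x.ofLp
  rw [h, quad]
  simpa only [star_trivial] using this

/-- The Sherman–Morrison update inverts the rank-one update of the covariance. -/
theorem covUpdate_mul {P G : Matrix (Fin d) (Fin d) ℝ} (hP : P * G = 1)
    {x : EuclideanSpace ℝ (Fin d)} (hx : 0 ≤ quad P x) :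
    covUpdate P x * (G + vecMulVec x.ofLp x.ofLp) = 1 := by
  have h1 : vecMulVec (P *ᵥ x.ofLp) (x.ofLp ᵥ* P) * G = vecMulVec (P *ᵥ x.ofLp) x.ofLp := by
    rw [vecMulVec_mul, vecMul_vecMul, hP, vecMul_one]
  have h2 : vecMulVec (P *ᵥ x.ofLp) (x.ofLp ᵥ* P) * vecMulVec x.ofLp x.ofLp =
      quad P x • vecMulVec (P *ᵥ x.ofLp) x.ofLp := by
    rw [vecMulVec_mul_vecMulVec, quad, dotProduct_mulVec, vecMulVec_smul]
  have h3 : (1 : ℝ) + quad P x ≠ 0 := by positivity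
  rw [covUpdate, sub_mul, mul_add, mul_add, hP, mul_vecMulVec, smul_mul_assoc, smul_mul_assoc, h1,
    h2, smul_smul]
  have h4 : ∀ T : Matrix (Fin d) (Fin d) ℝ,
      1 + T - ((1 / (1 + quad P x)) • T + (1 / (1 + quad P x) * quad P x) • T) =
        1 + (1 - 1 / (1 + quad P x) * (1 + quad P x)) • T := fun T => by
    module
  rw [h4, one_div_mul_cancel h3, sub_self, zero_smul, add_zero]

/-- The second-order update maintains the normal equations. -/
theorem mulVec_paramUpdate {P G : Matrix (Fin d) (Fin d) ℝ} (hP : P * G = 1)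
    {x θ : EuclideanSpace ℝ (Fin d)} (hx : 0 ≤ quad P x) (y : ℝ) :
    (G + vecMulVec x.ofLp x.ofLp) *ᵥ (paramUpdate θ P x (y - inner ℝ x θ)).ofLp =
      G *ᵥ θ.ofLp + y • x.ofLp := by
  have hG : G * P = 1 := mul_eq_one_comm.1 hP
  have h3 : (1 : ℝ) + quad P x ≠ 0 := by positivity
  have h4 : (y - inner ℝ x θ) / (1 + quad P x) * (1 + quad P x) = y - inner ℝ x θ :=
    div_mul_cancel₀ _ h3
  set k := (y - inner ℝ x θ) / (1 + quad P x)
  have e : (paramUpdate θ P x (y - inner ℝ x θ)).ofLp = θ.ofLp + k • (P *ᵥ x.ofLp) := rfl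
  rw [e, mulVec_add, add_mulVec, add_mulVec, mulVec_smul, mulVec_smul, mulVec_mulVec, hG,
    one_mulVec, vecMulVec_mulVec, vecMulVec_mulVec, op_smul_eq_smul, op_smul_eq_smul,
    ← inner_eq_dotProduct]
  change G *ᵥ θ.ofLp + _ + (k • x.ofLp + k • quad P x • x.ofLp) = _
  have h5 : y = inner ℝ x θ + k * (1 + quad P x) := by rw [h4]; ring
  generalize (inner ℝ x θ : ℝ) = i at *
  rw [h5]
  module

/-- Projecting a solution of the normal equations in the norm of the covariance minimizes the
regularized loss. -/
theorem quad_sub_eq_ridgeLoss {θ : EuclideanSpace ℝ (Fin d)}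
    (hθ : empCov lam z n *ᵥ θ.ofLp = empMoment z y n) (w w' : EuclideanSpace ℝ (Fin d)) :
    quad (empCov lam z n) (w - θ) - quad (empCov lam z n) (w' - θ) =
      ridgeLoss lam z y n w - ridgeLoss lam z y n w' := by
  have hnormal : ∀ v : EuclideanSpace ℝ (Fin d),
      lam * inner ℝ v θ + ∑ i ∈ Finset.range n, inner ℝ (z i) v * inner ℝ (z i) θ =
        ∑ i ∈ Finset.range n, y i * inner ℝ (z i) v := fun v => by
    rw [← dotProduct_empCov_mulVec, hθ, empMoment, dotProduct_sum]
    refine Finset.sum_congr rfl fun i _ => ?_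
    rw [dotProduct_smul, inner_eq_dotProduct, dotProduct_comm, smul_eq_mul]
  -- Completing the square: the normal equations replace the cross term, so the two objectives
  -- differ by a quantity independent of `v`.
  have key : ∀ v, quad (empCov lam z n) (v - θ) - quad (empCov lam z n) θ +
      ∑ i ∈ Finset.range n, y i ^ 2 = ridgeLoss lam z y n v := fun v => by
    have h := hnormal v
    have e1 : ∑ i ∈ Finset.range n, (inner ℝ (z i) (v - θ) : ℝ) ^ 2 =
        ∑ i ∈ Finset.range n, (inner ℝ (z i) v : ℝ) ^ 2 -
          2 * ∑ i ∈ Finset.range n, (inner ℝ (z i) v * inner ℝ (z i) θ : ℝ) +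
          ∑ i ∈ Finset.range n, (inner ℝ (z i) θ : ℝ) ^ 2 := by
      rw [Finset.mul_sum, ← Finset.sum_sub_distrib, ← Finset.sum_add_distrib]
      refine Finset.sum_congr rfl fun i _ => ?_
      rw [inner_sub_right]; ring
    have e2 : ∑ i ∈ Finset.range n, (inner ℝ (z i) v - y i : ℝ) ^ 2 =
        ∑ i ∈ Finset.range n, (inner ℝ (z i) v : ℝ) ^ 2 -
          2 * ∑ i ∈ Finset.range n, y i * inner ℝ (z i) v + ∑ i ∈ Finset.range n, y i ^ 2 := by
      rw [Finset.mul_sum, ← Finset.sum_sub_distrib, ← Finset.sum_add_distrib]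
      exact Finset.sum_congr rfl fun i _ => by ring
    rw [quad_empCov, quad_empCov, ridgeLoss, e1, e2, ← h, norm_sub_sq_real]
    ring
  linarith [key w, key w']

theorem continuous_quad (G : Matrix (Fin d) (Fin d) ℝ) : Continuous (quad G) := by
  unfold quad
  fun_prop

theorem project_spec (G : Matrix (Fin d) (Fin d) ℝ) (θ : EuclideanSpace ℝ (Fin d)) :
    project G θ ∈ unitBall d ∧ IsMinOn (fun w => quad G (w - θ)) (unitBall d) (project G θ) := by
  have : ∃ w, w ∈ unitBall d ∧ IsMinOn (fun w' => quad G (w' - θ)) (unitBall d) w :=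
    (isCompact_closedBall 0 1).exists_isMinOn ⟨0, Metric.mem_closedBall_self zero_le_one⟩
      ((continuous_quad G).comp (continuous_sub_right θ)).continuousOn
  exact Classical.epsilon_spec this

theorem ridgeLoss_project_le {P : Matrix (Fin d) (Fin d) ℝ} {θ : EuclideanSpace ℝ (Fin d)}
    (hP : P * empCov lam z n = 1) (hθ : empCov lam z n *ᵥ θ.ofLp = empMoment z y n)
    {w : EuclideanSpace ℝ (Fin d)} (hw : w ∈ unitBall d) :
    ridgeLoss lam z y n (project P⁻¹ θ) ≤ ridgeLoss lam z y n w := by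
  rw [Matrix.inv_eq_right_inv hP]
  have h1 := quad_sub_eq_ridgeLoss hθ (project (empCov lam z n) θ) w
  have h2 : quad (empCov lam z n) (project (empCov lam z n) θ - θ) ≤
      quad (empCov lam z n) (w - θ) := (project_spec (empCov lam z n) θ).2 hw
  linarith

end Ridge

/-! ### The invariant of the algorithm -/

section Run

variable {S A : Type*} [MeasurableSpace S] [MeasurableSpace A] [Fintype A] [Nonempty A]
  [MeasurableSingletonClass A] (M : MDP S A) {d : ℕ} (F : Features S A d) (b : QFun S A)
  (lam : ℝ) (x : ℕ → M.Traj)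

/-- Number of trajectories used before level `l` of epoch `e`. -/
def blockStart (H e l : ℕ) : ℕ := H * (2 ^ e - 2) + (H - 1 - l) * 2 ^ e

theorem blockStart_pred {H e l : ℕ} (hl : l < H) (hl0 : l ≠ 0) :
    blockStart H e l + 2 ^ e = blockStart H e (l - 1) := by
  have : H - 1 - (l - 1) = (H - 1 - l) + 1 := by omega
  rw [blockStart, blockStart, this]
  ring

/-- Epochs 1, …, e - 1 use H(2 + ⋯ + 2^(e-1)) = H(2^e - 2) trajectories, and level 0 is the last
block of its epoch. The case e = 0 must be excluded because there the subtraction truncates. -/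
theorem blockStart_succ {H e : ℕ} (hH : 0 < H) (he : 1 ≤ e) :
    blockStart H e 0 + 2 ^ e = blockStart H (e + 1) (H - 1) := by
  obtain ⟨k, hk⟩ : ∃ k, 2 ^ e = k + 2 :=
    ⟨2 ^ e - 2, (Nat.sub_add_cancel (le_self_pow₀ one_le_two (by omega))).symm⟩
  obtain ⟨m, rfl⟩ : ∃ m, H = m + 1 := ⟨H - 1, by omega⟩
  have h2 : k + 2 - 2 = k := by omega
  have h3 : (k + 2) * 2 - 2 = 2 * k + 2 := by omega
  rw [blockStart, blockStart, pow_succ, hk, h2, h3]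
  simp only [Nat.sub_zero, Nat.add_sub_cancel, Nat.sub_self, Nat.zero_mul]
  ring

/-- Features seen at stage `l`, from trajectory number `k` on. -/
def seenFeature (l : Fin M.H) (k i : ℕ) : EuclideanSpace ℝ (Fin d) :=
  F.φ l (x (k + i) l).1.1 (x (k + i) l).1.2

/-- Regression labels at stage `l`, from trajectory number `k` on. -/
def seenLabel (Q : QFun S A) (l : Fin M.H) (k i : ℕ) : ℝ :=
  (x (k + i) l).2.1 + maxQ Q (l + 1) (x (k + i) l).2.2

/-- `Q` is obtained at stage `l` by constrained ridge regression on the data of level `l` of epoch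
`e`, with `Q` itself as next-stage function. -/
def IsFitted (e : ℕ) (l : Fin M.H) (Q : QFun S A) : Prop :=
  ∃ w ∈ unitBall d, (Q l = fun s a => min 1 (F.lin w l s a + b l s a)) ∧
    ∀ w' ∈ unitBall d,
      ridgeLoss lam (seenFeature M F x l (blockStart M.H e l))
          (seenLabel M x Q l (blockStart M.H e l)) (2 ^ e) w ≤
        ridgeLoss lam (seenFeature M F x l (blockStart M.H e l))
          (seenLabel M x Q l (blockStart M.H e l)) (2 ^ e) w'

/-- Measurable, bounded by one, and zero after the last stage. -/
structure IsTarget (Q : QFun S A) : Prop where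
  measurable : ∀ h a, Measurable fun s => Q h s a
  abs_le_one : ∀ h s a, |Q h s a| ≤ 1
  eq_zero : ∀ h, M.H ≤ h → Q h = 0

/-- The invariant of the algorithm. -/
structure RunInvariant (K : ℕ) (st : State S A d) : Prop where
  one_le_epoch : 1 ≤ st.epoch
  level_lt : st.level < M.H
  count_lt : st.count < 2 ^ st.epoch
  played : K = blockStart M.H st.epoch st.level + st.count
  covInv : st.covInv st.level * empCov lam
    (seenFeature M F x ⟨st.level, level_lt⟩ (blockStart M.H st.epoch st.level)) st.count = 1
  normal : (empCov lam (seenFeature M F x ⟨st.level, level_lt⟩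
      (blockStart M.H st.epoch st.level)) st.count).mulVec (st.θ st.level).ofLp =
    empMoment (seenFeature M F x ⟨st.level, level_lt⟩ (blockStart M.H st.epoch st.level))
      (seenLabel M x st.Qtar ⟨st.level, level_lt⟩ (blockStart M.H st.epoch st.level)) st.count
  target : IsTarget M st.Qtar
  target_best : IsTarget M st.Qbest
  fitted : ∀ l : Fin M.H, st.level < l → IsFitted M F b lam x st.epoch l st.Qtar
  fitted_best : 2 ≤ st.epoch → ∀ l : Fin M.H, IsFitted M F b lam x (st.epoch - 1) l st.Qbest

variable {M F b lam x}

/-- Only the entries `l` and `l + 1` of the target enter, so a fit survives all later updates at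
lower levels of the epoch. -/
theorem IsFitted.congr {e : ℕ} {l : Fin M.H} {Q Q' : QFun S A} (h : IsFitted M F b lam x e l Q)
    (h0 : Q' l = Q l) (h1 : Q' (l + 1) = Q (l + 1)) : IsFitted M F b lam x e l Q' := by
  have : seenLabel M x Q' l = seenLabel M x Q l := by
    funext k i
    simp only [seenLabel, maxQ, h1]
  rw [IsFitted, this, h0]
  exact h

theorem startLevel_covInv_mul (hlam : 0 < lam) (st : State S A d) (l : ℕ)
    (z : ℕ → EuclideanSpace ℝ (Fin d)) :
    (startLevel lam st l).covInv l * empCov lam z 0 = 1 := by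
  have h1 : (startLevel lam st l).covInv l = (lam • (1 : Matrix (Fin d) (Fin d) ℝ))⁻¹ := by
    simp [startLevel]
  have h2 : empCov lam z 0 = lam • (1 : Matrix (Fin d) (Fin d) ℝ) := by simp [empCov]
  rw [h1, h2]
  refine Matrix.nonsing_inv_mul _ ?_
  rw [Matrix.det_smul, Matrix.det_one, mul_one]
  exact (IsUnit.mk0 _ hlam.ne').pow _

theorem startLevel_normal (st : State S A d) (l : ℕ) (z : ℕ → EuclideanSpace ℝ (Fin d))
    (y : ℕ → ℝ) :
    (empCov lam z 0).mulVec ((startLevel lam st l).θ l).ofLp = empMoment z y 0 := by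
  simp [startLevel, empMoment]

theorem runInvariant_init (hlam : 0 < lam) :
    RunInvariant M F b lam x 0 (initState M lam) where
  one_le_epoch := le_rfl
  level_lt := Nat.sub_lt M.H_pos one_pos
  count_lt := by simp [initState, startLevel]
  played := by simp [initState, startLevel, blockStart]
  covInv := startLevel_covInv_mul hlam _ _ _
  normal := startLevel_normal _ _ _ _
  target := ⟨fun h a => measurable_const, fun h s a => by simp [initState, startLevel],
    fun h _ => rfl⟩
  target_best := ⟨fun h a => measurable_const, fun h s a => by simp [initState, startLevel],
    fun h _ => rfl⟩
  fitted l hl := by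
    simp only [initState, startLevel] at hl
    omega
  fitted_best h := by simp [initState, startLevel] at h

theorem abs_lin_le_one {w : EuclideanSpace ℝ (Fin d)} (hw : w ∈ unitBall d) (h : ℕ) (s : S) (a : A) :
    |F.lin w h s a| ≤ 1 :=
  (abs_real_inner_le_norm _ _).trans
    (mul_le_one₀ (F.norm_φ_le h s a) (norm_nonneg _) (mem_closedBall_zero_iff.1 hw))

/-- Clipping from above suffices: the linear part is at least -1 and the bonus is nonnegative. -/
theorem abs_min_one_lin_add_le_one (hb0 : ∀ h s a, 0 ≤ b h s a)
    {w : EuclideanSpace ℝ (Fin d)} (hw : w ∈ unitBall d) (h : ℕ) (s : S) (a : A) :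
    |min 1 (F.lin w h s a + b h s a)| ≤ 1 :=
  abs_le.2 ⟨le_min (by norm_num)
    (by linarith [(abs_le.1 (abs_lin_le_one (F := F) hw h s a)).1, hb0 h s a]), min_le_left _ _⟩

theorem IsTarget.update (hb : ∀ h a, Measurable fun s => b h s a) (hb0 : ∀ h s a, 0 ≤ b h s a)
    {Q : QFun S A} (hQ : IsTarget M Q) {l : ℕ} (hl : l < M.H)
    {w : EuclideanSpace ℝ (Fin d)} (hw : w ∈ unitBall d) :
    IsTarget M (Function.update Q l fun s a => min 1 (F.lin w l s a + b l s a)) where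
  measurable h a := by
    by_cases hh : h = l
    · subst hh
      simp only [Function.update_self]
      exact measurable_const.min (((F.measurable_φ h a).inner measurable_const).add (hb h a))
    · simp only [Function.update_of_ne hh]
      exact hQ.measurable h a
  abs_le_one h s a := by
    by_cases hh : h = l
    · subst hh
      simp only [Function.update_self]
      exact abs_min_one_lin_add_le_one hb0 hw h s a
    · simp only [Function.update_of_ne hh]
      exact hQ.abs_le_one h s a
  eq_zero h hh := by
    rw [Function.update_of_ne (by omega)]
    exact hQ.eq_zero h hh

/-- Inside a block only the ridge statistics of the current level advance. At the end of a block the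
projected solution makes the new entry fitted, and the next level starts from an empty sample.
Parameters of other stages need no tracking, since each is reset before its own level begins. -/
theorem runInvariant_round (hlam : 0 < lam) (hb : ∀ h a, Measurable fun s => b h s a)
    (hb0 : ∀ h s a, 0 ≤ b h s a) {K : ℕ} {st : State S A d}
    (hst : RunInvariant M F b lam x K st) :
    RunInvariant M F b lam x (K + 1) (round M F b lam st (x K)) := by
  obtain ⟨he, hl, hc, hK, hcov, hnorm, hT, hTb, hfit, hfitb⟩ := hst
  set k := blockStart M.H st.epoch st.level with hk
  set z := seenFeature M F x ⟨st.level, hl⟩ k with hz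
  set y := seenLabel M x st.Qtar ⟨st.level, hl⟩ k with hy
  set st₁ := playTrajectory M F st (x K) with hst₁
  have hq := quad_nonneg_of_mul_empCov hlam hcov (z st.count)
  have hzK : F.φ st.level (x K ⟨st.level, hl⟩).1.1 (x K ⟨st.level, hl⟩).1.2 = z st.count := by
    rw [hK]; rfl
  have hcov₁ : st₁.covInv st.level * empCov lam z (st.count + 1) = 1 := by
    have : st₁.covInv st.level = covUpdate (st.covInv st.level) (z st.count) := by
      simp only [hst₁, playTrajectory, dif_pos hl, hzK]
    rw [this, empCov_succ]
    exact covUpdate_mul hcov hq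
  have hnorm₁ : (empCov lam z (st.count + 1)).mulVec (st₁.θ st.level).ofLp =
      empMoment z y (st.count + 1) := by
    have : st₁.θ st.level = paramUpdate (st.θ st.level) (st.covInv st.level) (z st.count)
        (y st.count - inner ℝ (z st.count) (st.θ st.level)) := by
      have htd : tdError F st.Qtar (st.θ st.level) st.level (x K ⟨st.level, hl⟩) =
          y st.count - inner ℝ (z st.count) (st.θ st.level) := by
        rw [tdError, Features.lin, hzK, hK]; rfl
      simp only [hst₁, playTrajectory, dif_pos hl, hzK, htd]
    rw [this, empCov_succ, mulVec_paramUpdate hcov hq, hnorm, empMoment, empMoment,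
      Finset.sum_range_succ]
  by_cases hlt : st.count + 1 < 2 ^ st.epoch
  · have hr : round M F b lam st (x K) = st₁ := if_pos hlt
    rw [hr]
    exact ⟨he, hl, hlt, by rw [hK]; rfl, hcov₁, hnorm₁, hT, hTb, hfit, hfitb⟩
  · have hcount : st.count + 1 = 2 ^ st.epoch := by omega
    rw [hcount] at hcov₁ hnorm₁
    set w := project (st₁.covInv st.level)⁻¹ (st₁.θ st.level) with hw
    set Q := Function.update st.Qtar st.level
      (fun s a => min 1 (F.lin w st.level s a + b st.level s a)) with hQdef
    have hwB : w ∈ unitBall d := (project_spec _ _).1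
    have hQ : IsTarget M Q := hT.update hb hb0 hl hwB
    have hQfit : ∀ l : Fin M.H, st.level ≤ l → IsFitted M F b lam x st.epoch l Q := by
      intro l hle
      rcases hle.eq_or_lt with heq | hlt'
      · obtain rfl : l = ⟨st.level, hl⟩ := Fin.ext heq.symm
        -- The labels read the target at the next stage, which the update of the current entry does
        -- not touch.
        have hlab : seenLabel M x Q ⟨st.level, hl⟩ k = y := by
          funext i
          simp only [hy, seenLabel, maxQ, hQdef]
          rw [Function.update_of_ne (by omega)]
        refine ⟨w, hwB, by simp [hQdef], fun w' hw' => ?_⟩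
        simp only [← hk, ← hz, hlab]
        exact ridgeLoss_project_le hcov₁ hnorm₁ hw'
      · exact (hfit l hlt').congr (Function.update_of_ne (by omega) _ _)
          (Function.update_of_ne (by omega) _ _)
    have hup : updateTarget F b st₁ = { st₁ with Qtar := Q } := rfl
    have hr : round M F b lam st (x K) =
        if st.level = 0 then startLevel lam
          { st₁ with Qtar := Q, epoch := st.epoch + 1, Qbest := Q } (M.H - 1)
        else startLevel lam { st₁ with Qtar := Q } (st.level - 1) := by
      exact if_neg hlt
    rw [hr]
    split_ifs with h0
    · refine ⟨Nat.le_add_left _ _, Nat.sub_lt M.H_pos one_pos, by simp [startLevel], ?_,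
        startLevel_covInv_mul hlam _ _ _, startLevel_normal _ _ _ _, hQ, hQ, fun l hl' => ?_,
        fun _ l => ?_⟩
      · rw [hK, hk, h0, add_assoc, hcount, blockStart_succ M.H_pos he]
        rfl
      · simp only [startLevel] at hl'
        omega
      · exact hQfit l (by omega)
    · refine ⟨he, (Nat.sub_le _ _).trans_lt hl, by simp [startLevel], ?_,
        startLevel_covInv_mul hlam _ _ _, startLevel_normal _ _ _ _, hQ, hTb, fun l hl' => ?_,
        hfitb⟩
      · rw [hK, hk, add_assoc, hcount, blockStart_pred hl h0]
        rfl
      · simp only [startLevel] at hl'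
        exact hQfit l (by omega)

theorem runInvariant_run (hlam : 0 < lam) (hb : ∀ h a, Measurable fun s => b h s a)
    (hb0 : ∀ h s a, 0 ≤ b h s a) (K : ℕ) :
    RunInvariant M F b lam x K (run M F b lam x K) := by
  induction K with
  | zero => exact runInvariant_init hlam
  | succ K ih => exact runInvariant_round hlam hb hb0 ih

/-- The output after `K ≥ 2H` trajectories is fitted on the last completed epoch, whose sample size
is comparable to `K / (4H)`. -/
theorem output_spec (hlam : 0 < lam) (hb : ∀ h a, Measurable fun s => b h s a)
    (hb0 : ∀ h s a, 0 ≤ b h s a) {K : ℕ} (hK : 2 * M.H ≤ K) :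
    1 ≤ epochsCompleted M F b lam x K ∧
      (K : ℝ) / (4 * M.H) ≤ 2 ^ epochsCompleted M F b lam x K ∧
      (2 : ℝ) ^ epochsCompleted M F b lam x K ≤ 4 * (K / (4 * M.H)) ∧
      IsTarget M (output M F b lam x K) ∧
      ∀ l : Fin M.H,
        IsFitted M F b lam x (epochsCompleted M F b lam x K) l (output M F b lam x K) := by
  have hinv := runInvariant_run (M := M) (F := F) (x := x) hlam hb hb0 K
  unfold epochsCompleted output
  set st := run M F b lam x K
  obtain ⟨he, hl, hc, hKe, -, -, -, hTb, -, hfitb⟩ := hinv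
  have hHpos := M.H_pos
  -- The current epoch is unfinished, so fewer trajectories have been played than all epochs up to
  -- it would use.
  have hup : K < M.H * (2 ^ (st.epoch + 1) - 2) := by
    have h1 : (M.H - 1 - st.level + 1) * 2 ^ st.epoch ≤ M.H * 2 ^ st.epoch :=
      Nat.mul_le_mul_right _ (by omega)
    have h2 : 2 ≤ 2 ^ st.epoch := le_self_pow₀ one_le_two (by omega)
    obtain ⟨m, hm⟩ : ∃ m, 2 ^ st.epoch = m + 2 := ⟨2 ^ st.epoch - 2, by omega⟩
    have h3 : (m + 2) * 2 - 2 = m + (m + 2) := by omega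
    rw [blockStart] at hKe
    rw [pow_succ]
    rw [hm] at hc hKe h1 ⊢
    rw [h3, Nat.mul_add]
    simp only [Nat.add_sub_cancel] at hKe
    rw [Nat.add_mul] at h1
    omega
  have hlow : M.H * (2 ^ st.epoch - 2) ≤ K := by
    rw [hKe, blockStart, add_assoc]; exact Nat.le_add_right _ _
  -- The first epoch takes exactly 2H trajectories, so it is complete.
  have he2 : 2 ≤ st.epoch := by
    by_contra hlt
    have : st.epoch = 1 := by omega
    rw [this] at hup
    norm_num at hup
    omega
  obtain ⟨e, hee⟩ : ∃ e, st.epoch = e + 1 := ⟨st.epoch - 1, by omega⟩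
  have he1 : 1 ≤ e := by omega
  rw [hee] at hup hlow hfitb ⊢
  simp only [Nat.add_sub_cancel] at hfitb ⊢
  have hH : (0 : ℝ) < M.H := by exact_mod_cast hHpos
  have h2e : 2 ≤ 2 ^ e := le_self_pow₀ one_le_two (by omega)
  obtain ⟨m, hm⟩ : ∃ m, 2 ^ e = m + 2 := ⟨2 ^ e - 2, by omega⟩
  have hmR : (2 : ℝ) ^ e = m + 2 := by exact_mod_cast hm
  refine ⟨he1, ?_, ?_, hTb, fun l => hfitb (by omega) l⟩
  · rw [div_le_iff₀ (by positivity), hmR]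
    have h5 : 2 ^ (e + 1 + 1) - 2 = 4 * m + 6 := by rw [pow_succ, pow_succ, hm]; omega
    rw [h5] at hup
    have h6 : (K : ℝ) < M.H * (4 * m + 6) := by exact_mod_cast hup
    nlinarith
  · have h5 : 2 ^ (e + 1) - 2 = 2 * m + 2 := by rw [pow_succ, hm]; omega
    rw [h5] at hlow
    have h6 : (M.H : ℝ) * (2 * m + 2) ≤ K := by exact_mod_cast hlow
    have h7 : (4 : ℝ) * (K / (4 * M.H)) = K / M.H := by field_simp
    rw [h7, le_div_iff₀ hH, hmR]
    have h8 : (0 : ℝ) ≤ M.H * m := by positivity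
    nlinarith

end Run

/-! ### Best fits over a convex set, and duality of quadratic norms -/

section BestFit

variable {d : ℕ}

/-- A minimizer of the squared distance over the unit ball is separated from the other elements
of the ball by at least the squared distance of the predictions. -/
theorem integral_sq_le_of_isMinOn {X : Type*} [MeasurableSpace X] (ν : Measure X)
    [IsProbabilityMeasure ν] {φ : X → EuclideanSpace ℝ (Fin d)} (hφm : Measurable φ)
    (hφ : ∀ x, ‖φ x‖ ≤ 1) {g : X → ℝ} (hg : Measurable g) {c : ℝ} (hc : ∀ x, |g x| ≤ c)
    {θ θ₀ : EuclideanSpace ℝ (Fin d)} (hθ : θ ∈ unitBall d) (hθ₀ : θ₀ ∈ unitBall d)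
    (hmin : IsMinOn (fun w => ∫ x, (inner ℝ (φ x) w - g x) ^ 2 ∂ν) (unitBall d) θ₀) :
    ∫ x, inner ℝ (φ x) (θ - θ₀) ^ 2 ∂ν ≤
      ∫ x, inner ℝ (φ x) (θ - θ₀) * (inner ℝ (φ x) θ + inner ℝ (φ x) θ₀ - 2 * g x) ∂ν := by
  have him : ∀ v, Measurable fun x => (inner ℝ (φ x) v : ℝ) := fun v => hφm.inner measurable_const
  have hib := fun v x => abs_inner_feature_le hφ x v
  set v := θ - θ₀ with hv
  have hres : ∀ x, |(inner ℝ (φ x) θ₀ : ℝ) - g x| ≤ ‖θ₀‖ + c := fun x =>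
    (abs_sub _ _).trans (add_le_add (hib θ₀ x) (hc x))
  have hmul : ∀ {f g : X → ℝ} {c c' : ℝ}, Measurable f → Measurable g → (∀ x, |f x| ≤ c) →
      (∀ x, |g x| ≤ c') → Integrable (fun x => f x * g x) ν := fun hf hg hfc hgc =>
    integrable_of_forall_abs_le (hf.mul hg) fun x => by
      rw [abs_mul]
      exact mul_le_mul (hfc x) (hgc x) (abs_nonneg _) ((abs_nonneg _).trans (hfc x))
  have hm0 : Measurable fun x => (inner ℝ (φ x) θ₀ : ℝ) - g x := (him θ₀).sub hg
  have iA : Integrable (fun x => (inner ℝ (φ x) v : ℝ) * inner ℝ (φ x) v) ν :=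
    hmul (him v) (him v) (hib v) (hib v)
  have iB : Integrable (fun x => (inner ℝ (φ x) v : ℝ) * (inner ℝ (φ x) θ₀ - g x)) ν :=
    hmul (him v) hm0 (hib v) hres
  have iC : Integrable (fun x => ((inner ℝ (φ x) θ₀ : ℝ) - g x) * (inner ℝ (φ x) θ₀ - g x)) ν :=
    hmul hm0 hm0 hres hres
  set a := ∫ x, (inner ℝ (φ x) v : ℝ) * inner ℝ (φ x) v ∂ν with ha
  set b := ∫ x, (inner ℝ (φ x) v : ℝ) * (inner ℝ (φ x) θ₀ - g x) ∂ν with hb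
  have hexp : ∀ t : ℝ, ∫ x, (inner ℝ (φ x) (θ₀ + t • v) - g x) ^ 2 ∂ν =
      ∫ x, (inner ℝ (φ x) θ₀ - g x) ^ 2 ∂ν + (2 * t * b + t ^ 2 * a) := fun t => by
    have e : ∀ x, (inner ℝ (φ x) (θ₀ + t • v) - g x : ℝ) ^ 2 =
        (inner ℝ (φ x) θ₀ - g x) * (inner ℝ (φ x) θ₀ - g x) +
          (2 * t * (inner ℝ (φ x) v * (inner ℝ (φ x) θ₀ - g x)) +
            t ^ 2 * (inner ℝ (φ x) v * inner ℝ (φ x) v)) := fun x => by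
      rw [inner_add_right, inner_smul_right]; ring
    have e' : ∀ x, (inner ℝ (φ x) θ₀ - g x : ℝ) ^ 2 =
        (inner ℝ (φ x) θ₀ - g x) * (inner ℝ (φ x) θ₀ - g x) := fun x => sq _
    simp_rw [e, e']
    have iBA : Integrable (fun x => 2 * t * ((inner ℝ (φ x) v : ℝ) * (inner ℝ (φ x) θ₀ - g x)) +
        t ^ 2 * (inner ℝ (φ x) v * inner ℝ (φ x) v)) ν := (iB.const_mul _).add (iA.const_mul _)
    rw [integral_add iC iBA,
      integral_add (iB.const_mul _) (iA.const_mul _), integral_const_mul, integral_const_mul]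
  have ha0 : 0 ≤ a := integral_nonneg fun x => mul_self_nonneg _
  -- First-order optimality of θ₀ in the direction of θ, which is admissible by convexity of the
  -- ball. No orthogonality is available, as the minimizer may lie on the boundary.
  have hb0 : 0 ≤ b := by
    by_contra hneg
    push Not at hneg
    -- With this step length t ≤ 1 and t·a < -b, so 2b + t·a is negative and moving towards θ would
    -- strictly decrease the loss.
    set t := -b / (-b + a + 1) with ht
    have hpos : 0 < -b + a + 1 := by linarith
    have ht0 : 0 < t := div_pos (by linarith) hpos
    have ht1 : t ≤ 1 := (div_le_one hpos).2 (by linarith)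
    have hmem : θ₀ + t • v ∈ unitBall d :=
      (convex_closedBall _ _).add_smul_sub_mem hθ₀ hθ ⟨ht0.le, ht1⟩
    have h1 : ∫ x, (inner ℝ (φ x) θ₀ - g x) ^ 2 ∂ν ≤
        ∫ x, (inner ℝ (φ x) (θ₀ + t • v) - g x) ^ 2 ∂ν := hmin hmem
    rw [hexp] at h1
    have h2 : t * (-b + a + 1) = -b := div_mul_cancel₀ _ hpos.ne'
    have h3 : 0 ≤ t * (2 * b + t * a) := by nlinarith
    have h4 : 0 ≤ 2 * b + t * a := nonneg_of_mul_nonneg_right h3 ht0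
    nlinarith
  have hfin : ∫ x, inner ℝ (φ x) v * (inner ℝ (φ x) θ + inner ℝ (φ x) θ₀ - 2 * g x) ∂ν =
      a + 2 * b := by
    have e : ∀ x, (inner ℝ (φ x) v * (inner ℝ (φ x) θ + inner ℝ (φ x) θ₀ - 2 * g x) : ℝ) =
        inner ℝ (φ x) v * inner ℝ (φ x) v +
          2 * (inner ℝ (φ x) v * (inner ℝ (φ x) θ₀ - g x)) := fun x => by
      rw [hv, inner_sub_right]; ring
    simp_rw [e]
    rw [integral_add iA (iB.const_mul _), integral_const_mul]
  have hsq : ∫ x, (inner ℝ (φ x) v : ℝ) ^ 2 ∂ν = a := by simp_rw [sq]; rfl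
  rw [hfin, hsq]
  linarith

/-- Cauchy–Schwarz inequality for the quadratic form of a positive definite matrix and that of its
inverse. -/
theorem abs_inner_le_sqrt_quad_mul {G : Matrix (Fin d) (Fin d) ℝ} (hG : G.PosDef)
    (x v : EuclideanSpace ℝ (Fin d)) :
    |(inner ℝ x v : ℝ)| ≤ √(quad G⁻¹ x) * √(quad G v) := by
  have hdet : IsUnit G.det := (Matrix.isUnit_iff_isUnit_det G).1 hG.isUnit
  have hsymm : G.transpose = G := by
    have := hG.isHermitian
    rwa [Matrix.IsHermitian, Matrix.conjTranspose_eq_transpose_of_trivial] at this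
  set u : EuclideanSpace ℝ (Fin d) := WithLp.toLp 2 (G⁻¹.mulVec x.ofLp) with hu
  have hGu : G.mulVec u.ofLp = x.ofLp := by
    rw [hu, Matrix.mulVec_mulVec, Matrix.mul_nonsing_inv _ hdet, Matrix.one_mulVec]
  have hux : quad G⁻¹ x = u.ofLp ⬝ᵥ x.ofLp := by rw [quad, dotProduct_comm]
  have hGv : u.ofLp ⬝ᵥ G.mulVec v.ofLp = inner ℝ x v := by
    rw [Matrix.dotProduct_mulVec, ← Matrix.mulVec_transpose, hsymm, hGu, inner_eq_dotProduct]
  -- This is the form of `G` at t·u + v with u = G⁻¹x; being nonnegative in `t`, it has nonpositive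
  -- discriminant.
  have hquad : ∀ t : ℝ, 0 ≤ quad G⁻¹ x * (t * t) + 2 * inner ℝ x v * t + quad G v := fun t => by
    have h := hG.posSemidef.dotProduct_mulVec_nonneg (t • u.ofLp + v.ofLp)
    rw [star_trivial, Matrix.mulVec_add, Matrix.mulVec_smul, dotProduct_add, add_dotProduct,
      add_dotProduct, hGu] at h
    simp only [smul_dotProduct, dotProduct_smul, smul_eq_mul] at h
    rw [hGv, dotProduct_comm v.ofLp x.ofLp, ← hux, ← inner_eq_dotProduct x v] at h
    change 0 ≤ _ + (_ + quad G v) at h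
    linarith
  have hd := discrim_le_zero hquad
  rw [discrim] at hd
  have hx0 : 0 ≤ quad G⁻¹ x := by
    have := hG.inv.posSemidef.dotProduct_mulVec_nonneg x.ofLp
    rw [quad]
    simpa only [star_trivial] using this
  rw [← Real.sqrt_mul hx0]
  exact Real.abs_le_sqrt (by nlinarith)

end BestFit

/-! ### Regression labels and their relation to the Bellman backup -/

section Statistics

variable {S A : Type*} [MeasurableSpace S] [MeasurableSpace A] [Fintype A] [Nonempty A]
  [MeasurableSingletonClass A] {M : MDP S A} {d : ℕ} {F : Features S A d} {b : QFun S A}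

variable (F) in
theorem measurable_feature (h : ℕ) : Measurable fun x : S × A => F.φ h x.1 x.2 :=
  measurable_uncurry_of_forall (F.measurable_φ h)

theorem quad_expectedCov (π : Controller S A) (lam n : ℝ) (h : Fin M.H)
    (v : EuclideanSpace ℝ (Fin d)) :
    quad (expectedCov M F π lam n h) v =
      n * M.expect (M.controllerLaw π) h (fun s a => (inner ℝ (F.φ h s a) v : ℝ) ^ 2) +
        lam * ‖v‖ ^ 2 := by
  have hev : Measurable fun τ : M.Traj => (τ h).1 := (measurable_pi_apply h).fst
  have hcoord : ∀ i, Measurable fun τ : M.Traj => (F.φ h (τ h).1.1 (τ h).1.2).ofLp i := fun i =>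
    (EuclideanSpace.proj (𝕜 := ℝ) i).continuous.measurable.comp
      ((measurable_feature F h).comp hev)
  have hcb : ∀ i (τ : M.Traj), |(F.φ h (τ h).1.1 (τ h).1.2).ofLp i| ≤ 1 := fun i τ =>
    (PiLp.norm_apply_le (F.φ h (τ h).1.1 (τ h).1.2) i).trans (F.norm_φ_le _ _ _)
  have hint : ∀ i j, Integrable (fun τ : M.Traj => (F.φ h (τ h).1.1 (τ h).1.2).ofLp i *
      (F.φ h (τ h).1.1 (τ h).1.2).ofLp j) (M.controllerLaw π) := fun i j =>
    integrable_of_forall_abs_le ((hcoord i).mul (hcoord j)) (c := 1) fun τ => by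
      rw [abs_mul]; exact mul_le_one₀ (hcb i τ) (abs_nonneg _) (hcb j τ)
  have hE : M.expect (M.controllerLaw π) h (fun s a => (inner ℝ (F.φ h s a) v : ℝ) ^ 2) =
      ∑ i, ∑ j, v.ofLp i * (v.ofLp j * M.expect (M.controllerLaw π) h
        (fun s a => (F.φ h s a).ofLp i * (F.φ h s a).ofLp j)) := by
    have e : ∀ τ : M.Traj, (inner ℝ (F.φ h (τ h).1.1 (τ h).1.2) v : ℝ) ^ 2 =
        ∑ i, ∑ j, v.ofLp i * (v.ofLp j * ((F.φ h (τ h).1.1 (τ h).1.2).ofLp i *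
          (F.φ h (τ h).1.1 (τ h).1.2).ofLp j)) := fun τ => by
      rw [inner_eq_dotProduct, dotProduct, sq, Finset.sum_mul_sum]
      exact Finset.sum_congr rfl fun i _ => Finset.sum_congr rfl fun j _ => by ring
    simp only [MDP.expect, e]
    rw [integral_finsetSum _ fun i _ => integrable_finsetSum _ fun j _ =>
      ((hint i j).const_mul _).const_mul _]
    refine Finset.sum_congr rfl fun i _ => ?_
    rw [integral_finsetSum _ fun j _ => ((hint i j).const_mul _).const_mul _]
    refine Finset.sum_congr rfl fun j _ => ?_
    rw [integral_const_mul, integral_const_mul]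
  rw [quad, expectedCov, Matrix.add_mulVec, dotProduct_add, Matrix.smul_mulVec, Matrix.smul_mulVec,
    Matrix.one_mulVec, dotProduct_smul, dotProduct_smul, ← inner_eq_dotProduct v v,
    real_inner_self_eq_norm_sq, hE]
  simp only [smul_eq_mul]
  congr 2
  simp only [dotProduct, Matrix.mulVec, Matrix.of_apply, Finset.mul_sum]
  exact Finset.sum_congr rfl fun i _ => Finset.sum_congr rfl fun j _ => by ring

theorem posDef_expectedCov (π : Controller S A) {lam n : ℝ} (hlam : 0 < lam) (hn : 0 ≤ n)
    (h : Fin M.H) : (expectedCov M F π lam n h).PosDef := by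
  refine Matrix.PosDef.of_dotProduct_mulVec_pos ?_ fun v hv => ?_
  · ext i j
    simp only [expectedCov, Matrix.conjTranspose_apply, Matrix.add_apply, Matrix.smul_apply,
      Matrix.of_apply, star_trivial, Matrix.one_apply, eq_comm (a := i) (b := j), mul_comm]
  · have h1 := quad_expectedCov (F := F) π lam n h (WithLp.toLp 2 v)
    rw [quad] at h1
    rw [star_trivial]
    simp only at h1
    rw [h1]
    have h2 : 0 < ‖WithLp.toLp 2 v‖ := norm_pos_iff.2 fun h0 => hv (by simpa using h0)
    have h3 : 0 ≤ M.expect (M.controllerLaw π) h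
        (fun s a => (inner ℝ (F.φ h s a) (WithLp.toLp 2 v) : ℝ) ^ 2) :=
      integral_nonneg fun _ => sq_nonneg _
    positivity

theorem expect_eq_integral_map (μ : Measure M.Traj) (h : Fin M.H) {f : S → A → ℝ}
    (hf : ∀ a, Measurable fun s => f s a) :
    M.expect μ h f = ∫ x, f x.1 x.2 ∂μ.map (fun τ => (τ h).1) := by
  rw [integral_map (measurable_pi_apply h).fst.aemeasurable
    (measurable_uncurry_of_forall hf).aestronglyMeasurable]
  rfl

variable (M F b) in
/-- The target network with parameter `w`. -/
def targetFamily (w : EuclideanSpace ℝ (Fin d)) : QFun S A := fun h s a =>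
  if h < M.H then min 1 (F.lin w h s a + b h s a) else 0

variable (M F b) in
/-- The regression label of a step at stage `h` for the target network with parameter `w`; the
reward is clipped, which changes it only on a null set. -/
def familyLabel (h : ℕ) (w : EuclideanSpace ℝ (Fin d)) (x : Step S A) : ℝ :=
  max (-1) (min 1 x.2.1) + maxQ (targetFamily M F b w) (h + 1) x.2.2

theorem abs_clip_le_one (r : ℝ) : |max (-1) (min 1 r)| ≤ 1 :=
  abs_le.2 ⟨le_max_left _ _, max_le (by norm_num) (min_le_left _ _)⟩

theorem clip_eq_self {r : ℝ} (hr : |r| ≤ 1) : max (-1) (min 1 r) = r := by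
  rw [min_eq_right (abs_le.1 hr).2, max_eq_right (abs_le.1 hr).1]

theorem abs_familyLabel_le (hb0 : ∀ h s a, 0 ≤ b h s a) (h : ℕ) {w : EuclideanSpace ℝ (Fin d)}
    (hw : w ∈ unitBall d) (x : Step S A) : |familyLabel M F b h w x| ≤ 2 := by
  have h1 : |maxQ (targetFamily M F b w) (h + 1) x.2.2| ≤ 1 := abs_maxQ_le fun a => by
    unfold targetFamily
    split_ifs
    · exact abs_min_one_lin_add_le_one hb0 hw _ _ _
    · simp
  exact (abs_add_le _ _).trans (by linarith [abs_clip_le_one x.2.1])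

/-- The bonus cancels, clipping and maximization are nonexpansive, and the features have norm at
most one. -/
theorem abs_familyLabel_sub_le (h : ℕ) (w w' : EuclideanSpace ℝ (Fin d)) (x : Step S A) :
    |familyLabel M F b h w x - familyLabel M F b h w' x| ≤ ‖w - w'‖ := by
  simp only [familyLabel, add_sub_add_left_eq_sub]
  refine abs_maxQ_sub_maxQ_le fun a => ?_
  unfold targetFamily
  split_ifs
  · refine (abs_min_sub_min_le_max _ _ _ _).trans (max_le (by simp) ?_)
    rw [add_sub_add_right_eq_sub, Features.lin, Features.lin, ← inner_sub_right]
    exact (abs_real_inner_le_norm _ _).trans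
      (mul_le_of_le_one_left (norm_nonneg _) (F.norm_φ_le _ _ _))
  · simp

theorem measurable_familyLabel (hb : ∀ h a, Measurable fun s => b h s a) (h : ℕ) :
    Measurable (Function.uncurry (familyLabel M F b h)) := by
  refine (measurable_const.max (measurable_const.min (by fun_prop))).add ?_
  refine Measurable.iSup fun a => ?_
  unfold targetFamily
  split_ifs
  · have hs : Measurable fun q : EuclideanSpace ℝ (Fin d) × Step S A => q.2.2.2 := by fun_prop
    exact measurable_const.min ((((F.measurable_φ (h + 1) a).comp hs).inner measurable_fst).add
      ((hb (h + 1) a).comp hs))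
  · exact measurable_const

/-- The next-stage values of a fitted target are those of a member of the parametric family. -/
theorem exists_maxQ_eq_targetFamily {Q : QFun S A} {lam : ℝ} {x : ℕ → M.Traj} {e : ℕ}
    (hQ : IsTarget M Q) (hfit : ∀ l : Fin M.H, IsFitted M F b lam x e l Q) (h : ℕ) :
    ∃ w ∈ unitBall d, maxQ Q (h + 1) = maxQ (targetFamily M F b w) (h + 1) := by
  by_cases hh : h + 1 < M.H
  · obtain ⟨w, hw, hwQ, -⟩ := hfit ⟨h + 1, hh⟩
    refine ⟨w, hw, ?_⟩
    funext s
    have : ∀ a, Q (h + 1) s a = targetFamily M F b w (h + 1) s a := fun a => by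
      rw [targetFamily, if_pos hh]
      exact congrFun (congrFun hwQ s) a
    simp only [maxQ, this]
  -- After the last stage the target vanishes whatever the parameter, so 0 serves as a default.
  · refine ⟨0, Metric.mem_closedBall_self zero_le_one, ?_⟩
    funext s
    simp [maxQ, targetFamily, if_neg hh, hQ.eq_zero (h + 1) (by omega)]

/-- Conditionally on the state-action pair, regression labels have the Bellman backup as mean. -/
theorem integral_familyLabel_step (hM : M.BoundedRewards) {Q : QFun S A} (hQ : IsTarget M Q)
    {h : Fin M.H} {w : EuclideanSpace ℝ (Fin d)}
    (hw : maxQ Q (h + 1) = maxQ (targetFamily M F b w) (h + 1)) (s : S) (a : A) :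
    ∫ q, familyLabel M F b h w ((s, a), q) ∂M.step h (s, a) = M.bellman Q h s a := by
  have hr : ∀ᵐ q ∂M.step h (s, a), max (-1) (min 1 q.1) = q.1 := by
    filter_upwards [hM h h.2 s a] with q hq using clip_eq_self hq
  have hm : Measurable fun q : ℝ × S => max (-1) (min 1 q.1) :=
    measurable_const.max (measurable_const.min measurable_fst)
  simp only [familyLabel, ← hw]
  rw [integral_add (integrable_of_forall_abs_le hm fun q => abs_clip_le_one q.1)
    (MDP.integrable_maxQ M (hQ.measurable (h + 1)) (hQ.abs_le_one (h + 1)) _ _),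
    integral_congr_ae hr, MDP.bellman, MDP.meanReward]

/-- The expected excess loss over a best on-policy fit dominates the squared distance of the
predictions. -/
theorem expect_sq_le_integral_excessLoss (hM : M.BoundedRewards)
    (hb : ∀ h a, Measurable fun s => b h s a) (hb0 : ∀ h s a, 0 ≤ b h s a) {Q : QFun S A}
    (hQ : IsTarget M Q) {π : Controller S A} {h : Fin M.H} {w θ θ₀ : EuclideanSpace ℝ (Fin d)}
    (hwB : w ∈ unitBall d) (hw : maxQ Q (h + 1) = maxQ (targetFamily M F b w) (h + 1))
    (hθ : θ ∈ unitBall d) (hθ₀ : IsBestPredictor M F π Q h θ₀) :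
    M.expect (M.controllerLaw π) h (fun s a => (inner ℝ (F.φ h s a) (θ - θ₀) : ℝ) ^ 2) ≤
      ∫ x, excessLoss (fun x : Step S A => F.φ h x.1.1 x.1.2) (familyLabel M F b h) (w, θ, θ₀) x
        ∂(M.controllerLaw π).map (fun τ => τ h) := by
  obtain ⟨hθ₀B, hmin⟩ := hθ₀
  have hev : Measurable fun τ : M.Traj => (τ h).1 := (measurable_pi_apply h).fst
  set ν := (M.controllerLaw π).map (fun τ => (τ h).1) with hν
  have : IsProbabilityMeasure ν := Measure.isProbabilityMeasure_map hev.aemeasurable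
  have hT := hM.isBoundedBefore_bellman hQ.measurable hQ.abs_le_one
  have hTm : Measurable fun x : S × A => M.bellman Q h x.1 x.2 :=
    measurable_uncurry_of_forall (hT.measurable h h.2)
  have hmin' : IsMinOn (fun v => ∫ x : S × A, (inner ℝ (F.φ h x.1 x.2) v -
      M.bellman Q h x.1 x.2) ^ 2 ∂ν) (unitBall d) θ₀ := by
    have e : ∀ v : EuclideanSpace ℝ (Fin d), M.expect (M.controllerLaw π) h
        (fun s a => (F.lin v h s a - M.bellman Q h s a) ^ 2) =
        ∫ x : S × A, (inner ℝ (F.φ h x.1 x.2) v - M.bellman Q h x.1 x.2) ^ 2 ∂ν := fun v =>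
      expect_eq_integral_map _ h fun a => ((((F.measurable_φ h a).inner measurable_const)).sub
        (hT.measurable h h.2 a)).pow_const 2
    simpa only [e] using hmin
  have key := integral_sq_le_of_isMinOn ν (measurable_feature F h)
    (fun x => F.norm_φ_le h x.1 x.2) hTm (fun x => hT.abs_le h h.2 x.1 x.2) hθ hθ₀B hmin'
  rw [expect_eq_integral_map _ h fun a => ((F.measurable_φ h a).inner measurable_const).pow_const 2]
  refine key.trans_eq ?_
  have hφm : Measurable fun x : Step S A => F.φ h x.1.1 x.1.2 :=
    (measurable_feature F h).comp measurable_fst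
  have hexm : Measurable (excessLoss (fun x : Step S A => F.φ h x.1.1 x.1.2)
      (familyLabel M F b h) (w, θ, θ₀)) :=
    (measurable_uncurry_excessLoss hφm (measurable_familyLabel hb h)).of_uncurry_left
  have hexb : ∀ x, |excessLoss (fun x : Step S A => F.φ h x.1.1 x.1.2)
      (familyLabel M F b h) (w, θ, θ₀) x| ≤ 6 * ‖θ - θ₀‖ := fun x => by
    have h1 := abs_excessLoss_le (φ := fun x : Step S A => F.φ h x.1.1 x.1.2)
      (Y := familyLabel M F b h) (fun x => F.norm_φ_le h x.1.1 x.1.2)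
      (fun w hw x => abs_familyLabel_le hb0 h hw x) hwB hθ hθ₀B x
    have h2 := abs_inner_feature_le (φ := fun x : Step S A => F.φ h x.1.1 x.1.2)
      (fun x => F.norm_φ_le h x.1.1 x.1.2) x (θ - θ₀)
    exact h1.trans (mul_le_mul_of_nonneg_left h2 (by norm_num))
  rw [MDP.map_law_step, ← hν, Measure.integral_compProd (integrable_of_forall_abs_le hexm hexb)]
  refine integral_congr_ae (ae_of_all _ fun x => ?_)
  obtain ⟨s, a⟩ := x
  have hlm : Measurable (familyLabel M F b h w) := (measurable_familyLabel hb h).of_uncurry_left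
  have hlab : Integrable (fun q => familyLabel M F b h w ((s, a), q)) (M.step h (s, a)) :=
    integrable_of_forall_abs_le (hlm.comp measurable_prodMk_left)
      fun q => abs_familyLabel_le hb0 h hwB _
  -- The squared label cancels, so the excess loss is affine in the label and only the conditional
  -- mean of the label matters.
  have e : ∀ q, excessLoss (fun x : Step S A => F.φ h x.1.1 x.1.2)
      (familyLabel M F b h) (w, θ, θ₀) ((s, a), q) =
      inner ℝ (F.φ h s a) (θ - θ₀) * (inner ℝ (F.φ h s a) θ + inner ℝ (F.φ h s a) θ₀) -
        2 * inner ℝ (F.φ h s a) (θ - θ₀) * familyLabel M F b h w ((s, a), q) := fun q => by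
    simp only [excessLoss]
    rw [inner_sub_right]
    ring
  simp_rw [e]
  rw [integral_sub (integrable_const _) (hlab.const_mul _), integral_const, integral_const_mul,
    integral_familyLabel_step hM hQ hw]
  simp only [probReal_univ, one_smul]
  ring

end Statistics

/-! ### High-probability event, uncertainty bound and regret -/

section Guarantee

variable {S A Ω : Type*} [MeasurableSpace S] [MeasurableSpace A] [MeasurableSpace Ω] [Fintype A]
  [Nonempty A] [MeasurableSingletonClass A] {P : Measure Ω} [IsProbabilityMeasure P] {M : MDP S A}
  {d : ℕ} {F : Features S A d} {b : QFun S A} {lam : ℝ} {π : Controller S A}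
  {ξ : ℕ → Ω → M.Traj}

/-- With high probability, all targets fitted on the data of a given level and epoch are close to
their best on-policy fits. -/
theorem exists_event_fitted_close (hM : M.BoundedRewards)
    (hb : ∀ h a, Measurable fun s => b h s a) (hb0 : ∀ h s a, 0 ≤ b h s a) (hlam : 0 < lam)
    (hξ : ∀ k, Measurable (ξ k)) (hind : iIndepFun ξ P)
    (hlaw : ∀ k, P.map (ξ k) = M.controllerLaw π) (e : ℕ) (l : Fin M.H) {t : ℝ} (ht : 0 < t) :
    ∃ T : Set Ω, MeasurableSet T ∧ P Tᶜ ≤ ENNReal.ofReal t ∧ ∀ ω ∈ T,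
      (∀ k, |(ξ k ω l).2.1| ≤ 1) → ∀ Q : QFun S A, IsTarget M Q →
      (∀ l', IsFitted M F b lam (fun k => ξ k ω) e l' Q) →
      ∀ θ₀, IsBestPredictor M F π Q l θ₀ →
      ∃ w ∈ unitBall d, (Q l = fun s a => min 1 (F.lin w l s a + b l s a)) ∧
        2 ^ e * M.expect (M.controllerLaw π) l
            (fun s a => (inner ℝ (F.φ l s a) (w - θ₀) : ℝ) ^ 2) ≤
          2 * lam + 144 * (2 + 3 * d * Real.log (2 ^ e) + Real.log t⁻¹) := by
  set k₀ := blockStart M.H e l with hk₀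
  have hev : Measurable fun τ : M.Traj => τ l := measurable_pi_apply l
  have : IsProbabilityMeasure ((M.controllerLaw π).map fun τ => τ l) :=
    Measure.isProbabilityMeasure_map hev.aemeasurable
  have hsamp : ∀ i : Fin (2 ^ e), Measurable fun ω => ξ (k₀ + i) ω l := fun i =>
    hev.comp (hξ (k₀ + i))
  have hsind : iIndepFun (fun (i : Fin (2 ^ e)) ω => ξ (k₀ + i) ω l) P := by
    have hinj : Function.Injective fun i : Fin (2 ^ e) => k₀ + (i : ℕ) := fun i j hij =>
      Fin.ext (Nat.add_left_cancel hij)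
    exact (hind.precomp hinj).comp (fun _ τ => τ l) fun _ => hev
  have hslaw : ∀ i : Fin (2 ^ e), P.map (fun ω => ξ (k₀ + i) ω l) =
      (M.controllerLaw π).map fun τ => τ l := fun i => by
    rw [← hlaw (k₀ + i), Measure.map_map hev (hξ _)]
    rfl
  obtain ⟨T, hTm, hTP, hT⟩ := exists_event_excessLoss_le P
    ((M.controllerLaw π).map fun τ => τ l) (φ := fun x : Step S A => F.φ l x.1.1 x.1.2)
    (Y := familyLabel M F b l) ((measurable_feature F l).comp measurable_fst)
    (fun x => F.norm_φ_le l x.1.1 x.1.2) (measurable_familyLabel hb l)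
    (fun w hw x => abs_familyLabel_le hb0 l hw x) (fun w w' x => abs_familyLabel_sub_le l w w' x)
    (Nat.two_pow_pos e) hsamp hsind hslaw ht
  refine ⟨T, hTm, hTP, fun ω hω hr Q hQ hfit θ₀ hθ₀ => ?_⟩
  -- The parameter `w'` of the next-stage target depends on the data; this is harmless because the
  -- event is uniform over the ball.
  obtain ⟨w', hw', hmax⟩ := exists_maxQ_eq_targetFamily hQ hfit l
  obtain ⟨w, hw, hQl, hridge⟩ := hfit l
  refine ⟨w, hw, hQl, ?_⟩
  have hdev := hT ω hω w' hw' w hw θ₀ hθ₀.1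
  have hbest := expect_sq_le_integral_excessLoss hM hb hb0 hQ hw' hmax hw hθ₀
  rw [← hk₀] at hridge
  set z := seenFeature M F (fun k => ξ k ω) l k₀
  set y := seenLabel M (fun k => ξ k ω) Q l k₀
  have hy : ∀ i, familyLabel M F b l w' (ξ (k₀ + i) ω l) = y i := fun i => by
    simp only [familyLabel, ← hmax, clip_eq_self (hr (k₀ + i)), y, seenLabel]
  -- The best fit lies in the ball and so competes in the ridge problem; its penalty is at most λ.
  have hsum : ∑ i : Fin (2 ^ e), excessLoss (fun x : Step S A => F.φ l x.1.1 x.1.2)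
      (familyLabel M F b l) (w', w, θ₀) (ξ (k₀ + i) ω l) ≤ lam := by
    have e1 : ∀ i : Fin (2 ^ e), excessLoss (fun x : Step S A => F.φ l x.1.1 x.1.2)
        (familyLabel M F b l) (w', w, θ₀) (ξ (k₀ + i) ω l) =
        (inner ℝ (z i) w - y i) ^ 2 - (inner ℝ (z i) θ₀ - y i) ^ 2 := fun i => by
      simp only [excessLoss, hy]; rfl
    simp_rw [e1]
    rw [Fin.sum_univ_eq_sum_range
      (fun i => (inner ℝ (z i) w - y i) ^ 2 - (inner ℝ (z i) θ₀ - y i) ^ 2), Finset.sum_sub_distrib]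
    have h1 := hridge θ₀ hθ₀.1
    rw [ridgeLoss, ridgeLoss] at h1
    have h2 : ‖θ₀‖ ^ 2 ≤ 1 := pow_le_one₀ (norm_nonneg _) (mem_closedBall_zero_iff.1 hθ₀.1)
    have h3 : lam * ‖θ₀‖ ^ 2 ≤ lam := mul_le_of_le_one_right hlam.le h2
    have h4 : 0 ≤ lam * ‖w‖ ^ 2 := by positivity
    linarith
  have hexp : M.expect (M.controllerLaw π) l
      (fun s a => (inner ℝ (F.φ l s a) (w - θ₀) : ℝ) ^ 2) =
      ∫ x, (inner ℝ (F.φ l x.1.1 x.1.2) (w - θ₀) : ℝ) ^ 2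
        ∂(M.controllerLaw π).map fun τ => τ l := by
    have hm : Measurable fun x : Step S A => (inner ℝ (F.φ l x.1.1 x.1.2) (w - θ₀) : ℝ) ^ 2 :=
      (((measurable_feature F l).comp measurable_fst).inner measurable_const).pow_const 2
    rw [integral_map hev.aemeasurable hm.aestronglyMeasurable]
    rfl
  rw [← hexp] at hdev
  push_cast at hdev
  have h2e : (0 : ℝ) < 2 ^ e := by positivity
  -- The mean excess is at least the squared distance, of which the deviation inequality subtracts
  -- only half. Doubling turns λ and 72 into 2λ and 144.
  have h5 := mul_le_mul_of_nonneg_left hbest h2e.le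
  rw [mul_sub] at hdev
  linarith

/-- The comparison of logarithms behind the choice of the uncertainty parameter. -/
theorem deviation_le_uncertainty {d H e : ℕ} (hd : 0 < d) (hH : 0 < H) (he : 1 ≤ e) {δ n : ℝ}
    (hδ : 0 < δ) (hδ1 : δ < 1) (hn : 1 / 2 ≤ n) (hen : (2 : ℝ) ^ e ≤ 4 * n) :
    2 + 3 * d * Real.log (2 ^ e) + Real.log (δ / (2 * H * e ^ 2))⁻¹ ≤
      6 * (d * Real.log (d * n * Real.exp 1 * H / (δ / (2 * H * e ^ 2 * d)))) := by
  have hd1 : (1 : ℝ) ≤ d := by exact_mod_cast hd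
  have hH1 : (1 : ℝ) ≤ H := by exact_mod_cast hH
  have he1 : (1 : ℝ) ≤ e := by exact_mod_cast he
  have hn0 : 0 < n := by linarith
  set q := 2 * (H : ℝ) * e ^ 2 / δ with hq
  have hqinv : (δ / (2 * H * e ^ 2))⁻¹ = q := by rw [inv_div]
  have hq2 : 2 ≤ q := by
    rw [hq, le_div_iff₀ hδ]
    have : (1 : ℝ) ≤ H * e ^ 2 := one_le_mul_of_one_le_of_one_le hH1 (one_le_pow₀ he1)
    nlinarith
  have hq0 : 0 < q := by linarith
  have harg : d * n * Real.exp 1 * H / (δ / (2 * H * e ^ 2 * d)) =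
      (d ^ 2 * H) * (n * Real.exp 1 * q) := by
    rw [hq]; field_simp
  have hdH : (1 : ℝ) ≤ d ^ 2 * H := one_le_mul_of_one_le_of_one_le (one_le_pow₀ hd1) hH1
  rw [harg, hqinv]
  set L := Real.log ((d ^ 2 * H) * (n * Real.exp 1 * q)) with hL
  -- Since n ≥ 1/2 and q ≥ 2, this makes each of 1, log(2^e) and log q at most `L`, and the constant
  -- 6 is 2 + 3 + 1.
  have hL1 : Real.log n + 1 + Real.log q ≤ L := by
    have h1 : Real.log (n * Real.exp 1 * q) = Real.log n + 1 + Real.log q := by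
      rw [Real.log_mul (by positivity) hq0.ne', Real.log_mul hn0.ne' (Real.exp_pos 1).ne',
        Real.log_exp]
    rw [← h1]
    exact Real.log_le_log (by positivity) (le_mul_of_one_le_left (by positivity) hdH)
  have hlog2 := Real.log_two_lt_d9
  have hlogn : -Real.log 2 ≤ Real.log n := by
    rw [← Real.log_inv]
    exact Real.log_le_log (by norm_num) (by linarith)
  have hlogq : Real.log 2 ≤ Real.log q := Real.log_le_log (by norm_num) hq2
  have hloge : Real.log (2 ^ e) ≤ 2 * Real.log 2 + Real.log n := by
    have h1 : Real.log (4 * n) = 2 * Real.log 2 + Real.log n := by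
      rw [Real.log_mul (by norm_num) hn0.ne', show (4 : ℝ) = 2 ^ 2 by norm_num, Real.log_pow]
      norm_num
    rw [← h1]
    exact Real.log_le_log (by positivity) hen
  have hL0 : 1 ≤ L := by linarith
  have hLe : Real.log (2 ^ e) ≤ L := by linarith
  have hLq : Real.log q ≤ L := by linarith
  have hdL : L ≤ d * L := le_mul_of_one_le_left (by linarith) hd1
  have h3 : (d : ℝ) * Real.log (2 ^ e) ≤ d * L := by gcongr
  linarith

/-- The budget δ/(2He²) per level, summed over levels and epochs, is δ/2 · π²/6, which is below δ.
-/
theorem tsum_failure_le {H : ℕ} (hH : 0 < H) {δ : ℝ} (hδ : 0 < δ) :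
    ∑' e : ℕ, ∑ _l : Fin H, ENNReal.ofReal (δ / (2 * H * ((e + 1 : ℕ) : ℝ) ^ 2)) ≤
      ENNReal.ofReal δ := by
  have hHR : (0 : ℝ) < H := by exact_mod_cast hH
  have hz := hasSum_zeta_two
  have hz1 : HasSum (fun e : ℕ => (1 : ℝ) / ((e + 1 : ℕ) : ℝ) ^ 2) (Real.pi ^ 2 / 6) := by
    have := (hasSum_nat_add_iff' 1).2 hz
    simpa using this
  have hs : HasSum (fun e : ℕ => δ / 2 * (1 / ((e + 1 : ℕ) : ℝ) ^ 2))
      (δ / 2 * (Real.pi ^ 2 / 6)) := hz1.mul_left _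
  have e1 : ∀ e : ℕ, ∑ _l : Fin H, ENNReal.ofReal (δ / (2 * H * ((e + 1 : ℕ) : ℝ) ^ 2)) =
      ENNReal.ofReal (δ / 2 * (1 / ((e + 1 : ℕ) : ℝ) ^ 2)) := fun e => by
    rw [Finset.sum_const, Finset.card_univ, Fintype.card_fin, nsmul_eq_mul,
      ← ENNReal.ofReal_natCast, ← ENNReal.ofReal_mul hHR.le]
    congr 1
    field_simp
  simp_rw [e1]
  rw [← ENNReal.ofReal_tsum_of_nonneg (fun e => by positivity) hs.summable, hs.tsum_eq]
  refine ENNReal.ofReal_le_ofReal ?_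
  have h1 := Real.pi_lt_d2
  have h2 : Real.pi ^ 2 ≤ 12 := by nlinarith [Real.pi_pos]
  nlinarith

/-- The good event: every target fitted in some epoch is close to its best on-policy fits. -/
theorem exists_event_all_fitted_close (hM : M.BoundedRewards)
    (hb : ∀ h a, Measurable fun s => b h s a) (hb0 : ∀ h s a, 0 ≤ b h s a) (hlam : 0 < lam)
    (hξ : ∀ k, Measurable (ξ k)) (hind : iIndepFun ξ P)
    (hlaw : ∀ k, P.map (ξ k) = M.controllerLaw π) {δ : ℝ} (hδ : 0 < δ) :
    ∃ T : Set Ω, MeasurableSet T ∧ ENNReal.ofReal (1 - δ) ≤ P T ∧ ∀ ω ∈ T,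
      ∀ e, 1 ≤ e → ∀ (l : Fin M.H) (Q : QFun S A), IsTarget M Q →
      (∀ l', IsFitted M F b lam (fun k => ξ k ω) e l' Q) →
      ∀ θ₀, IsBestPredictor M F π Q l θ₀ →
      ∃ w ∈ unitBall d, (Q l = fun s a => min 1 (F.lin w l s a + b l s a)) ∧
        2 ^ e * M.expect (M.controllerLaw π) l
            (fun s a => (inner ℝ (F.φ l s a) (w - θ₀) : ℝ) ^ 2) ≤
          2 * lam + 144 * (2 + 3 * d * Real.log (2 ^ e) +
            Real.log (δ / (2 * M.H * e ^ 2))⁻¹) := by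
  have hHR : (0 : ℝ) < M.H := by exact_mod_cast M.H_pos
  have hpos : ∀ e : ℕ, 0 < δ / (2 * M.H * ((e + 1 : ℕ) : ℝ) ^ 2) := fun e => by positivity
  choose T hTm hTP hT using fun (e : ℕ) (l : Fin M.H) =>
    exists_event_fitted_close (F := F) hM hb hb0 hlam hξ hind hlaw (e + 1) l (hpos e)
  -- The clipped labels agree with the observed ones only where rewards are bounded, so a null set
  -- is removed, as a union over countably many trajectories and stages.
  have hrew : ∀ (k : ℕ) (l : Fin M.H), ∀ᵐ ω ∂P, |(ξ k ω l).2.1| ≤ 1 := fun k l => by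
    have hev : Measurable fun τ : M.Traj => τ l := measurable_pi_apply l
    have hset : MeasurableSet {x : Step S A | |x.2.1| ≤ 1} :=
      measurableSet_le (by fun_prop : Measurable fun x : Step S A => |x.2.1|) measurable_const
    have : IsProbabilityMeasure ((M.controllerLaw π).map fun τ => (τ l).1) :=
      Measure.isProbabilityMeasure_map hev.fst.aemeasurable
    have h1 : ∀ᵐ x ∂(M.controllerLaw π).map (fun τ => τ l), |x.2.1| ≤ 1 := by
      rw [MDP.map_law_step, Measure.ae_compProd_iff hset]
      exact ae_of_all _ fun x => hM l l.2 x.1 x.2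
    rw [ae_map_iff hev.aemeasurable hset, ← hlaw k] at h1
    exact ae_of_ae_map (hξ k).aemeasurable h1
  set R := {ω | ∀ (k : ℕ) (l : Fin M.H), |(ξ k ω l).2.1| ≤ 1} with hR
  have hRm : MeasurableSet R := by
    have : R = ⋂ k, ⋂ l, {ω | |(ξ k ω l).2.1| ≤ 1} := by ext ω; simp [hR]
    rw [this]
    refine MeasurableSet.iInter fun k => MeasurableSet.iInter fun l => ?_
    have hev : Measurable fun ω => ξ k ω l := (measurable_pi_apply l).comp (hξ k)
    exact measurableSet_le (hev.snd.fst.abs) measurable_const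
  have hRP : P Rᶜ = 0 := by
    have : ∀ᵐ ω ∂P, ω ∈ R := ae_all_iff.2 fun k => ae_all_iff.2 fun l => hrew k l
    exact this
  have hGm : MeasurableSet (R ∩ ⋂ e, ⋂ l, T e l) :=
    hRm.inter (MeasurableSet.iInter fun e => MeasurableSet.iInter fun l => hTm e l)
  refine ⟨R ∩ ⋂ e, ⋂ l, T e l, hGm, ?_, fun ω hω e he l Q hQ hfit θ₀ hθ₀ => ?_⟩
  · have hcompl : P (R ∩ ⋂ e, ⋂ l, T e l)ᶜ ≤ ENNReal.ofReal δ := by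
      rw [Set.compl_inter]
      refine (measure_union_le _ _).trans ?_
      rw [hRP, zero_add, Set.compl_iInter]
      refine (measure_iUnion_le _).trans (le_trans (ENNReal.tsum_le_tsum fun e => ?_)
        (tsum_failure_le M.H_pos hδ))
      rw [Set.compl_iInter]
      refine (measure_iUnion_fintype_le _ _).trans (Finset.sum_le_sum fun l _ => hTP e l)
    rw [ENNReal.ofReal_sub _ hδ.le, ENNReal.ofReal_one, tsub_le_iff_right]
    calc (1 : ℝ≥0∞) = P (R ∩ ⋂ e, ⋂ l, T e l) + P (R ∩ ⋂ e, ⋂ l, T e l)ᶜ :=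
          (prob_add_prob_compl hGm).symm
      _ ≤ _ := by gcongr
  · obtain ⟨e, rfl⟩ : ∃ e', e = e' + 1 := ⟨e - 1, by omega⟩
    exact hT e l ω (Set.mem_iInter.1 (Set.mem_iInter.1 hω.2 e) l) (fun k => hω.1 k l) Q hQ hfit
      θ₀ hθ₀

/-- The majorant may have infinite integral, and it is not assumed measurable. Comparison therefore
goes through the positive part of the integrable function. -/
theorem coe_integral_le_coe_lintegral {X : Type*} [MeasurableSpace X] {μ : Measure X} {f g : X → ℝ}
    (hf : Integrable f μ) (hfg : ∀ x, f x ≤ g x) :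
    ((∫ x, f x ∂μ : ℝ) : EReal) ≤ ((∫⁻ x, ENNReal.ofReal (g x) ∂μ : ℝ≥0∞) : EReal) := by
  have hfin : ∫⁻ x, ENNReal.ofReal (f x) ∂μ ≠ ∞ := hf.lintegral_lt_top.ne
  have h1 : ∫ x, f x ∂μ ≤ (∫⁻ x, ENNReal.ofReal (f x) ∂μ).toReal := by
    rw [integral_eq_lintegral_pos_part_sub_lintegral_neg_part hf]
    exact sub_le_self _ ENNReal.toReal_nonneg
  calc ((∫ x, f x ∂μ : ℝ) : EReal)
      ≤ (((∫⁻ x, ENNReal.ofReal (f x) ∂μ).toReal : ℝ) : EReal) := EReal.coe_le_coe_iff.2 h1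
    _ = ((∫⁻ x, ENNReal.ofReal (f x) ∂μ : ℝ≥0∞) : EReal) := EReal.coe_ennreal_toReal hfin
    _ ≤ _ := EReal.coe_ennreal_le_coe_ennreal_iff.2
        (lintegral_mono fun x => ENNReal.ofReal_le_ofReal (hfg x))

/-- Parameters that are close on-policy give predictions that differ by at most the uncertainty. -/
theorem abs_lin_sub_le_uncertainty (hlam : 0 < lam) (hd : 0 < d) {δ : ℝ} (hδ : 0 < δ)
    (hδ1 : δ < 1) {K e : ℕ} (he : 1 ≤ e) (hK : 2 * M.H ≤ K) (hKe : (K : ℝ) / (4 * M.H) ≤ 2 ^ e)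
    (heK : (2 : ℝ) ^ e ≤ 4 * (K / (4 * M.H))) {h : Fin M.H} {w θ : EuclideanSpace ℝ (Fin d)}
    (hw : w ∈ unitBall d) (hθ : θ ∈ unitBall d)
    (hclose : 2 ^ e * M.expect (M.controllerLaw π) h
        (fun s a => (inner ℝ (F.φ h s a) (w - θ) : ℝ) ^ 2) ≤
      2 * lam + 144 * (2 + 3 * d * Real.log (2 ^ e) + Real.log (δ / (2 * M.H * e ^ 2))⁻¹))
    (s : S) (a : A) :
    |F.lin w h s a - F.lin θ h s a| ≤ uncertainty M F π 30 lam δ K e h s a := by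
  have hH : (0 : ℝ) < M.H := by exact_mod_cast M.H_pos
  have hn : 1 / 2 ≤ (K : ℝ) / (4 * M.H) := by
    rw [le_div_iff₀ (by positivity)]
    have : (2 * M.H : ℝ) ≤ K := by exact_mod_cast hK
    linarith
  have hdev := deviation_le_uncertainty hd M.H_pos he hδ hδ1 hn heK
  simp only [uncertainty]
  set n := (K : ℝ) / (4 * M.H)
  set B := (d : ℝ) * Real.log (d * n * Real.exp 1 * M.H / (δ / (2 * M.H * e ^ 2 * d))) with hB
  set X := M.expect (M.controllerLaw π) h (fun s a => (inner ℝ (F.φ h s a) (w - θ) : ℝ) ^ 2)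
  have hX : 0 ≤ X := integral_nonneg fun _ => sq_nonneg _
  have hB0 : 0 ≤ B := by
    have h1 : 0 ≤ (2 : ℝ) ^ e * X := by positivity
    have h2 : 0 ≤ 3 * (d : ℝ) * Real.log (2 ^ e) := by
      have : 0 ≤ Real.log (2 ^ e) := Real.log_nonneg (one_le_pow₀ one_le_two)
      positivity
    have h3 : 0 ≤ Real.log (δ / (2 * M.H * e ^ 2))⁻¹ := by
      refine Real.log_nonneg ?_
      have he1 : (1 : ℝ) ≤ e := by exact_mod_cast he
      have hH1 : (1 : ℝ) ≤ M.H := by exact_mod_cast M.H_pos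
      have : (1 : ℝ) ≤ M.H * e ^ 2 := one_le_mul_of_one_le_of_one_le hH1 (one_le_pow₀ he1)
      rw [inv_div, le_div_iff₀ hδ]
      linarith
    linarith
  -- The sampled part gives 2λ + 144·6·B and the regularization at most 4λ, since ‖w - θ‖ ≤ 2. Both
  -- 864 and 6 are below 900 = 30², whence the constant 30.
  have hquad : quad (expectedCov M F π lam n h) (w - θ) ≤ 900 * (B + lam) := by
    rw [quad_expectedCov]
    have h1 : n * X ≤ 2 ^ e * X := by gcongr
    have h2 : ‖w - θ‖ ≤ 2 := (norm_sub_le _ _).trans (by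
      linarith [mem_closedBall_zero_iff.1 hw, mem_closedBall_zero_iff.1 hθ])
    have h3 : ‖w - θ‖ ^ 2 ≤ 2 ^ 2 := pow_le_pow_left₀ (norm_nonneg _) h2 2
    have h4 : lam * ‖w - θ‖ ^ 2 ≤ lam * 2 ^ 2 := by gcongr
    linarith
  have hsqrt : √(quad (expectedCov M F π lam n h) (w - θ)) ≤ 30 * (√B + √lam) := by
    refine Real.sqrt_le_iff.2 ⟨by positivity, hquad.trans ?_⟩
    have h1 := Real.sq_sqrt hB0
    have h2 := Real.sq_sqrt hlam.le
    have h3 : 0 ≤ √B * √lam := by positivity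
    nlinarith
  have hcs := abs_inner_le_sqrt_quad_mul
    (posDef_expectedCov (F := F) π hlam (by linarith : 0 ≤ n) h) (F.φ h s a) (w - θ)
  rw [Features.lin, Features.lin, ← inner_sub_right]
  refine hcs.trans ?_
  rw [mul_comm, uncertaintyParam]
  gcongr

/-- The regret of a greedy policy is bounded by its expected uncertainty and the
misspecification. -/
theorem coe_integral_maxQ_sub_value_le (hM : M.BoundedRewards) {Q : QFun S A} (hQ : IsTarget M Q)
    {C : Set (Controller S A)} {ε : ℝ} (hmis : LowRankMisspecified M F C ε) (hπ : π ∈ C)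
    {U : Fin M.H → S → A → ℝ}
    (hU : ∀ (h : Fin M.H) (θ : EuclideanSpace ℝ (Fin d)), IsBestPredictor M F π Q h θ → ∀ s a,
      bellmanError M Q h s a + comparatorError M F Q h θ s a ≤ U h s a + b h s a)
    {π' : Policy S A} (hπ' : IsGreedy M.H Q π') :
    ((∫ s, (maxQ Q 0 s - M.value π' 0 s) ∂M.ρ : ℝ) : EReal) ≤
      ((∫⁻ τ, ENNReal.ofReal (∑ h : Fin M.H,
        (U h (τ h).1.1 (τ h).1.2 + b h (τ h).1.1 (τ h).1.2)) ∂M.law π' : ℝ≥0∞) : EReal) +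
        (ε : EReal) := by
  have hQA : Q ∈ M.QAll := ⟨hQ.measurable, hQ.abs_le_one, hQ.eq_zero _ le_rfl⟩
  -- The low-rank condition provides only some choice of best fits. It may be used because the
  -- pointwise bound holds for every best fit.
  obtain ⟨θ, hθ, hε⟩ := hmis π hπ π' Q hQA
  rw [hM.integral_maxQ_sub_value hQA hπ']
  have hT := hM.isBoundedBefore_bellman hQ.measurable hQ.abs_le_one
  have hev : ∀ h : Fin M.H, Measurable fun τ : M.Traj => (τ h).1 := fun h =>
    (measurable_pi_apply h).fst
  have hcomp : ∀ {g : S → A → ℝ} {c : ℝ} (h : Fin M.H), (∀ a, Measurable fun s => g s a) →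
      (∀ s a, |g s a| ≤ c) → Integrable (fun τ : M.Traj => g (τ h).1.1 (τ h).1.2) (M.law π') :=
    fun h hg hc => integrable_of_forall_abs_le ((measurable_uncurry_of_forall hg).comp (hev h))
      fun τ => hc _ _
  have hlin : ∀ h : Fin M.H, ∀ a, Measurable fun s => F.lin (θ h) h s a := fun h a =>
    (F.measurable_φ h a).inner measurable_const
  have i1 : ∀ h : Fin M.H, Integrable (fun τ : M.Traj => bellmanError M Q h (τ h).1.1 (τ h).1.2 +
      comparatorError M F Q h (θ h) (τ h).1.1 (τ h).1.2) (M.law π') := fun h => by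
    -- The Bellman backup cancels, which leaves a bounded function even when the bonus is unbounded.
    have e : ∀ s a, bellmanError M Q h s a + comparatorError M F Q h (θ h) s a =
        Q h s a - F.lin (θ h) h s a := fun s a => by
      simp only [bellmanError, comparatorError]; ring
    simp only [e]
    exact hcomp (g := fun s a => Q h s a - F.lin (θ h) h s a) h
      (fun a => (hQ.measurable h a).sub (hlin h a)) fun s a =>
        (abs_sub _ _).trans (add_le_add (hQ.abs_le_one h s a) (abs_lin_le_one (hθ h).1 h s a))
  have i2 : ∀ h : Fin M.H, Integrable (fun τ : M.Traj => F.lin (θ h) h (τ h).1.1 (τ h).1.2 -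
      M.bellman Q h (τ h).1.1 (τ h).1.2) (M.law π') := fun h =>
    hcomp (g := fun s a => F.lin (θ h) h s a - M.bellman Q h s a) h
      (fun a => (hlin h a).sub (hT.measurable h h.2 a)) fun s a =>
        (abs_sub _ _).trans (add_le_add (abs_lin_le_one (hθ h).1 h s a) (hT.abs_le h h.2 s a))
  have hsplit : ∫ τ, ∑ h : Fin M.H, bellmanError M Q h (τ h).1.1 (τ h).1.2 ∂M.law π' =
      ∫ τ, ∑ h : Fin M.H, (bellmanError M Q h (τ h).1.1 (τ h).1.2 +
        comparatorError M F Q h (θ h) (τ h).1.1 (τ h).1.2) ∂M.law π' +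
      ∑ h : Fin M.H, M.expect (M.law π') h
        fun s a => F.lin (θ h) h s a - M.bellman Q h s a := by
    simp only [MDP.expect]
    rw [← integral_finsetSum _ fun h _ => i2 h,
      ← integral_add (integrable_finsetSum _ fun h _ => i1 h)
        (integrable_finsetSum _ fun h _ => i2 h)]
    refine integral_congr_ae (ae_of_all _ fun τ => ?_)
    simp only
    rw [← Finset.sum_add_distrib]
    refine Finset.sum_congr rfl fun h _ => ?_
    simp only [comparatorError]
    ring
  rw [hsplit, EReal.coe_add]
  exact add_le_add (coe_integral_le_coe_lintegral (integrable_finsetSum _ fun h _ => i1 h)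
    fun τ => Finset.sum_le_sum fun h _ => hU h (θ h) (hθ h) _ _)
    (EReal.coe_le_coe_iff.2 ((le_abs_self _).trans hε))

end Guarantee

end S3Q

end

/-! ### The two claims on the good event -/

theorem theorem3 :
    ∃ c : ℝ, 0 < c ∧
      ∀ (S : Type*) (A : Type*) (Ω : Type*)
        [MeasurableSpace S] [MeasurableSpace A] [MeasurableSpace Ω]
        [Fintype A] [Nonempty A] [MeasurableSingletonClass A]
        (P : Measure Ω) [IsProbabilityMeasure P]
        (M : S3Q.MDP S A) (d : ℕ) (F : S3Q.Features S A d)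
        (C : Set (S3Q.Controller S A)) (π : S3Q.Controller S A)
        (b : S3Q.QFun S A) (ε lam δ : ℝ) (ξ : ℕ → Ω → M.Traj),
        0 < d →
        M.BoundedRewards →
        S3Q.LowRankMisspecified M F C ε →
        π ∈ C →
        (∀ h a, Measurable fun s => b h s a) →
        (∀ h s a, 0 ≤ b h s a) →
        0 < lam →
        0 < δ →
        δ < 1 →
        (∀ k, Measurable (ξ k)) →
        iIndepFun ξ P →
        (∀ k, P.map (ξ k) = M.controllerLaw π) →
        ∃ E : Set Ω, MeasurableSet E ∧ ENNReal.ofReal (1 - δ) ≤ P E ∧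
          ∀ ω ∈ E, ∀ K : ℕ, 2 * M.H ≤ K →
            let x : ℕ → M.Traj := fun k => ξ k ω
            let Q : S3Q.QFun S A := S3Q.output M F b lam x K
            let U : Fin M.H → S → A → ℝ :=
              S3Q.uncertainty M F π c lam δ K (S3Q.epochsCompleted M F b lam x K)
            (∀ (h : Fin M.H) (θ : EuclideanSpace ℝ (Fin d)),
              S3Q.IsBestPredictor M F π Q h θ → ∀ (s : S) (a : A),
                min 0 (-U h s a + b h s a) ≤
                    S3Q.bellmanError M Q h s a + S3Q.comparatorError M F Q h θ s a ∧
                  S3Q.bellmanError M Q h s a + S3Q.comparatorError M F Q h θ s a ≤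
                    U h s a + b h s a) ∧
            (∀ π' : S3Q.Policy S A, S3Q.IsGreedy M.H Q π' →
              ∫ s, (S3Q.maxQ Q 0 s - M.optValue 0 s) ∂M.ρ ≤
                  ∫ s, (S3Q.maxQ Q 0 s - M.value π' 0 s) ∂M.ρ ∧
                ((∫ s, (S3Q.maxQ Q 0 s - M.value π' 0 s) ∂M.ρ : ℝ) : EReal) ≤
                  ((∫⁻ τ, ENNReal.ofReal (∑ h : Fin M.H,
                      (U h (τ h).1.1 (τ h).1.2 + b h (τ h).1.1 (τ h).1.2)) ∂M.law π' : ℝ≥0∞) :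
                    EReal) + (ε : EReal)) := by
  refine ⟨30, by norm_num, ?_⟩
  intro S A Ω _ _ _ _ _ _ P _ M d F C π b ε lam δ ξ hd hM hmis hπ hb hb0 hlam hδ hδ1 hξ hind hlaw
  obtain ⟨T, hTm, hTP, hT⟩ :=
    S3Q.exists_event_all_fitted_close (F := F) hM hb hb0 hlam hξ hind hlaw hδ
  refine ⟨T, hTm, hTP, fun ω hω K hK => ?_⟩
  intro x Q U
  obtain ⟨he, hKe, heK, hQ, hfit⟩ :=
    S3Q.output_spec (M := M) (F := F) (x := x) hlam hb hb0 hK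
  have hU : ∀ (h : Fin M.H) (θ : EuclideanSpace ℝ (Fin d)),
      S3Q.IsBestPredictor M F π Q h θ → ∀ (s : S) (a : A),
        min 0 (-U h s a + b h s a) ≤
            S3Q.bellmanError M Q h s a + S3Q.comparatorError M F Q h θ s a ∧
          S3Q.bellmanError M Q h s a + S3Q.comparatorError M F Q h θ s a ≤
            U h s a + b h s a := by
    intro h θ hθ s a
    obtain ⟨w, hw, hQw, hclose⟩ := hT ω hω _ he h Q hQ hfit θ hθ
    have hlin : |F.lin w h s a - F.lin θ h s a| ≤ U h s a :=
      S3Q.abs_lin_sub_le_uncertainty hlam hd hδ hδ1 he hK hKe heK hw hθ.1 hclose s a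
    have hsum : S3Q.bellmanError M Q h s a + S3Q.comparatorError M F Q h θ s a =
        min 1 (F.lin w h s a + b h s a) - F.lin θ h s a := by
      rw [S3Q.bellmanError, S3Q.comparatorError, congrFun (congrFun hQw s) a]
      ring
    have hθ1 := (abs_le.1 (S3Q.abs_lin_le_one (F := F) hθ.1 h s a)).2
    obtain ⟨hlin1, hlin2⟩ := abs_le.1 hlin
    rw [hsum]
    constructor
    -- If the target is clipped at one, the error is nonnegative because ⟨φ, θ⟩ ≤ 1; this is the
    -- source of the minimum with 0 in the lower bound.
    · rcases min_choice 1 (F.lin w h s a + b h s a) with hmin | hmin <;> rw [hmin]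
      · exact (min_le_left _ _).trans (by linarith)
      · exact (min_le_right _ _).trans (by linarith)
    · linarith [min_le_right 1 (F.lin w h s a + b h s a)]
  exact ⟨hU, fun π' hπ' =>
    ⟨hM.integral_sub_optValue_le ⟨hQ.measurable, hQ.abs_le_one, hQ.eq_zero _ le_rfl⟩ π',
      S3Q.coe_integral_maxQ_sub_value_le hM hQ hmis hπ (fun h θ hθ s a => (hU h θ hθ s a).2) hπ'⟩⟩
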